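/- **Setting.** Let $\Sigma=(\mathbb Z_{\ge 0})^{\mathbb Z}$ with the product $\sigma$-algebra and the pointwise order $\preccurlyeq$. Write $[a,b]$ for the set of integers between $a$ and $b$ (also for real $a,b$). For an interval $I$ of integers, $|I|$ is its number of elements and $\eta(I)=\sum_{x\in I}\eta(x)$. The time set $\mathbb T$ is $\mathbb Z_{\ge 0}$ or $[0,\infty)$ (or any canonically ordered semiring with a floor function). An environment consists of a non-empty bounded open interval $J\subseteq\mathbb R_+$, probability measures $(\mu_\rho)_{\rho\in J}$ on $\Sigma$, and probability measures $(\mathbf P^{\eta_0})_{\eta_0\in\Sigma}$ on the paths $\eta=(\eta_t)_{t\in\mathbb T}$ in $\Sigma$, measurable in $\eta_0$. Put $\mathbf P^\rho=\int\mu_\rho(d\eta_0)\,\mathbf P^{\eta_0}$. A coupling is a joint law with the given marginals. Fix $\nu>0$ and $0\le p_\circ<p_\bullet\le 1$. The conditions are the following. * **(P.1)** Under $\mathbf P^{\eta_0}$, $\eta$ starts from $\eta_0$, and for all times $s$ and all $x\in\mathbb Z$ the conditional law of $(\eta_{s+t}(x+\cdot))_{t\ge 0}$ given $(\eta_r)_{r\le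 s}$ is $\mathbf P^{\eta_s(x+\cdot)}$. * **(P.2)** For $\rho\in J$, the law $\mathbf P^\rho$ is invariant under time shifts, and $\mu_\rho$ is invariant under the translations of $\mathbb Z$. * **(P.3)** If $\eta_0'\preccurlyeq\eta_0$, there is a coupling of $\mathbf P^{\eta_0'}$ and $\mathbf P^{\eta_0}$ such that, for all $t$, $\eta_t'\preccurlyeq\eta_t$ almost surely. If $\rho'\le\rho$ are in $J$, there is a coupling of $\mu_{\rho'}$ and $\mu_\rho$ such that $\eta'\preccurlyeq\eta$ almost surely. * **(P.4)** There is $c>0$ such that $\mathbf P^\rho(|\eta_0([0,\ell-1])-\rho\ell|\ge\varepsilon\ell)\le 2e^{-c\varepsilon^2\ell}$ for all $\rho\in J$, $\varepsilon\in(0,1)$ and integers $\ell\ge 1$. * **(C.2.1)** For all integers $t,H\ge 0$ and $k\ge 1$, and all $\eta_0,\eta_0'\in\Sigma$ with $\eta_0'(x)\le\eta_0(x)$ for $x\in[-H,H]$, there is a coupling $\mathbb Q$ of $\eta\sim\mathbf P^{\eta_0}$ and $\eta'\sim\mathbf P^{\eta_0'}$ with $$\mathbb Q\big(\forall s\in[0,t],\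 \forall x\in[-H+2\nu kt,\,H-2\nu kt]:\ \eta'_s(x)\le\eta_s(x)\big)\ \ge\ 1-20e^{-k\nu t/4}.$$ * **(C.2.2)** There are $C,C'>0$ such that the following holds for all $\rho\in J$ and $\varepsilon\in(0,1)$ with $\rho+\varepsilon\in J$, and all integers $H,t\ge 1$ with $H>4\nu t$, $\nu^8t>1$ and $\nu t^{1/4}>C\varepsilon^{-2}(1+|\log^3(\nu t)|)$. Let $\ell=\lfloor t^{1/4}\rfloor$. If $\eta_0,\eta_0'\in\Sigma$ satisfy $\eta_0(I)\ge(\rho+3\varepsilon/4)|I|$ and $\eta_0'(I)\le(\rho+\varepsilon/4)|I|$ for every non-empty interval $I\subseteq[-H,H]$ with $\lfloor\ell/2\rfloor\le|I|\le\ell$, then there is a coupling $\mathbb Q$ of $\eta\sim\mathbf P^{\eta_0}$ and $\eta'\sim\mathbf P^{\eta_0'}$ with $$\mathbb Q\big(\forall x\in[-H+4\nu t,\,H-4\nu t]:\ \eta'_t(x)\le\eta_t(x)\big)\ \ge\ 1-C'tH\exp\!\big(-(C'(1+\nu^{-1}))^{-1}\varepsilon^2t^{1/4}\big).$$ **The walk.**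 Given $\eta$, and $U_0,U_1,\dots$ independent and uniform on $[0,1]$, independent of $\eta$, let $X_0=0$ and $$X_{n+1}=X_n+2\cdot\mathbf 1\{U_n\le(p_\circ-p_\bullet)\mathbf 1\{\eta_n(X_n)=0\}+p_\bullet\}-1 .$$ For an integer $L\ge 1$, let $\mathbf P^{\rho,L}$ be the law of the environment whose restrictions to the time blocks $[kL,(k+1)L)$, $k\ge 0$, are independent and each distributed as $(\eta_s)_{0\le s<L}$ under $\mathbf P^\rho$. Let $v(\rho,L)=\mathbb E[X_L/L]$ for the walk $X$ in an environment with law $\mathbf P^{\rho,L}$. Let $v(\rho)=\lim_{L\to\infty}v(\rho,L)$ where this limit exists, and let $\bar J$ be the set of $\rho\in J$ for which it exists. **Proposition.** Let $\nu>0$ and $0\le p_\circ<p_\bullet\le 1$, and let the environment satisfy (P.1)–(P.4), (C.2.1) and (C.2.2). Then for all $\rho\in J$ and $\varepsilon>0$ with $\rho+\varepsilon\in J$, $$\limsup_{L\to\infty}v(\rho,L)\ \le\ \liminf_{L\to\infty}v(\rho+\varepsilon,L).$$ Moreover, $J\setminus\bar J$ is countable (possibly finite or empty), and $v$ is non-decreasing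 on $\bar J$. -/

import Mathlib

open MeasureTheory ProbabilityTheory Filter Topology

noncomputable section

/-- Particle configurations `Σ = (ℤ≥0)^ℤ`, with the product `σ`-algebra and the pointwise order. -/
abbrev Config : Type := ℤ → ℕ

/-- `η(I)` for the interval of integers `I = [a, b]`: the number of particles in `I`. -/
def count (η : Config) (a b : ℤ) : ℕ := ∑ x ∈ Finset.Icc a b, η x

/-- `Q` is a coupling of the laws `P` and `P'`. -/
def IsCoupling {Ω Ω' : Type*} [MeasurableSpace Ω] [MeasurableSpace Ω']
    (Q : Measure (Ω × Ω')) (P : Measure Ω) (P' : Measure Ω') : Prop :=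
  Q.map Prod.fst = P ∧ Q.map Prod.snd = P'

/-! ### The random walk -/

/-- The walk started from `0` that is driven by the environment `η` and the variables `u 0, u 1, …`:
`X₀ = 0` and `Xₙ₊₁ = Xₙ + 2 · 1{Uₙ ≤ (p∘ - p•) 1{ηₙ(Xₙ) = 0} + p•} - 1`.
It looks at the environment at integer times only. -/
def walk {T : Type*} [NatCast T] (pEmpty pOcc : ℝ) (η : T → Config) (u : ℕ → unitInterval) : ℕ → ℤ
  | 0 => 0
  | n + 1 =>
    walk pEmpty pOcc η u n +
      2 * (if (u n : ℝ) ≤ (pEmpty - pOcc) *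
            (if η (n : T) (walk pEmpty pOcc η u n) = 0 then 1 else 0) + pOcc then 1 else 0) - 1

/-- The law of a sequence of independent uniform variables on `[0, 1]`. -/
def uniformSeqLaw : Measure (ℕ → unitInterval) :=
  Measure.infinitePi fun _ : ℕ => (volume : Measure unitInterval)

instance : IsProbabilityMeasure uniformSeqLaw := by
  unfold uniformSeqLaw; infer_instance

/-- The quenched law `P^η` of the walk in the fixed environment `η`. -/
def quenchedLaw {T : Type*} [NatCast T] (pEmpty pOcc : ℝ) (η : T → Config) : Measure (ℕ → ℤ) :=
  uniformSeqLaw.map (walk pEmpty pOcc η)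

/-- The annealed law `∫ P(dη) P^η` of the walk when the environment has law `P`. -/
def annealedLaw {T : Type*} [NatCast T] (pEmpty pOcc : ℝ) (P : Measure (T → Config)) :
    Measure (ℕ → ℤ) :=
  P.bind (quenchedLaw pEmpty pOcc)

lemma measurable_walk_joint {T : Type*} [NatCast T] (pEmpty pOcc : ℝ) :
    Measurable fun q : (T → Config) × (ℕ → unitInterval) => walk pEmpty pOcc q.1 q.2 := by
  refine measurable_pi_lambda _ fun n => ?_
  induction n with
  | zero => exact measurable_const
  | succ n ih =>
    have hη : Measurable fun q : (T → Config) × (ℕ → unitInterval) =>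
        q.1 (n : T) (walk pEmpty pOcc q.1 q.2 n) := by
      have h : Measurable fun r : Config × ℤ => r.1 r.2 :=
        measurable_from_prod_countable_left fun x => measurable_pi_apply x
      exact h.comp ((((measurable_pi_apply (n : T)).comp measurable_fst)).prodMk ih)
    have hu : Measurable fun q : (T → Config) × (ℕ → unitInterval) => ((q.2 n : unitInterval) : ℝ) :=
      measurable_subtype_coe.comp ((measurable_pi_apply n).comp measurable_snd)
    have hI : Measurable fun q : (T → Config) × (ℕ → unitInterval) =>
        (pEmpty - pOcc) *
          (if q.1 (n : T) (walk pEmpty pOcc q.1 q.2 n) = 0 then (1 : ℝ) else 0) + pOcc :=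
      ((Measurable.ite (hη (measurableSet_singleton 0)) measurable_const
        measurable_const).const_mul _).add_const _
    have hJ : Measurable fun q : (T → Config) × (ℕ → unitInterval) =>
        (if (q.2 n : ℝ) ≤ (pEmpty - pOcc) *
          (if q.1 (n : T) (walk pEmpty pOcc q.1 q.2 n) = 0 then (1 : ℝ) else 0) + pOcc
          then (1 : ℤ) else 0) :=
      Measurable.ite (measurableSet_le hu hI) measurable_const measurable_const
    exact (ih.add (hJ.const_mul 2)).sub_const 1

/-- The quenched laws depend measurably on the environment, so that `annealedLaw` is the integral of
the quenched laws. -/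
lemma measurable_quenchedLaw {T : Type*} [NatCast T] (pEmpty pOcc : ℝ) :
    Measurable fun η : T → Config => quenchedLaw pEmpty pOcc η := by
  refine Measure.measurable_of_measurable_coe _ fun s hs => ?_
  have h := measurable_walk_joint (T := T) pEmpty pOcc
  have e : (fun η : T → Config => quenchedLaw pEmpty pOcc η s) =
      fun η => uniformSeqLaw (Prod.mk η ⁻¹' ((fun q : (T → Config) × (ℕ → unitInterval) =>
        walk pEmpty pOcc q.1 q.2) ⁻¹' s)) := by
    funext η
    exact Measure.map_apply (h.comp measurable_prodMk_left) hs
  rw [e]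
  exact measurable_measure_prodMk_left (h hs)

/-! ### Environments -/

/-- The data of an environment with time set `T` (such as `ℕ` or `ℝ≥0`): a non-empty bounded open
interval `J = (lo, hi)` of non-negative reals, the initial laws `μ ρ` for `ρ ∈ J` (the values of `μ`
outside of `J` are never used), and the laws `𝐏^{η₀}`, which depend measurably on the initial
configuration `η₀`. -/
structure RandomEnvironment (T : Type*) where
  lo : ℝ
  hi : ℝ
  lo_nonneg : 0 ≤ lo
  lo_lt_hi : lo < hi
  μ : ℝ → Measure Config
  prob_μ : ∀ ρ, IsProbabilityMeasure (μ ρ)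
  law : Kernel Config (T → Config)
  markov_law : IsMarkovKernel law

namespace RandomEnvironment

section basic

variable {T : Type*} (E : RandomEnvironment T)

instance (ρ : ℝ) : IsProbabilityMeasure (E.μ ρ) := E.prob_μ ρ

instance : IsMarkovKernel E.law := E.markov_law

/-- The interval `J` of densities. -/
def J : Set ℝ := Set.Ioo E.lo E.hi

/-- `𝐏^ρ = ∫ μ_ρ(dη₀) 𝐏^{η₀}`. -/
def stationaryLaw (ρ : ℝ) : Measure (T → Config) := (E.μ ρ).bind E.law

instance (ρ : ℝ) : IsProbabilityMeasure (E.stationaryLaw ρ) := by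
  unfold stationaryLaw; infer_instance

/-- The `σ`-algebra generated by `η_r`, `r ≤ s`. -/
abbrev past [LE T] (s : T) : MeasurableSpace (T → Config) :=
  MeasurableSpace.comap (fun (η : T → Config) (r : {r : T // r ≤ s}) => η r) inferInstance

end basic

section conditions

variable {T : Type*} [CommSemiring T] [LinearOrder T] (E : RandomEnvironment T)

/-- Markov property and invariance: under `𝐏^{η₀}` the process starts from `η₀` and, for all times
`s` and all `x ∈ ℤ`, the conditional law of `(η_{s+t}(x + ·))_{t ≥ 0}` given `(η_r)_{r ≤ s}` is
`𝐏^{η_s(x + ·)}`. -/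
def MarkovInvariant : Prop :=
  (∀ η₀ : Config, ∀ᵐ η ∂(E.law η₀), η 0 = η₀) ∧
  ∀ (η₀ : Config) (s : T) (x : ℤ) (A B : Set (T → Config)),
    MeasurableSet[past s] A → MeasurableSet B →
      E.law η₀ (A ∩ {η | (fun (t : T) (y : ℤ) => η (s + t) (x + y)) ∈ B}) =
        ∫⁻ η in A, E.law (fun y : ℤ => η s (x + y)) B ∂(E.law η₀)

/-- Stationarity in time of `𝐏^ρ`. -/
def Stationary : Prop :=
  ∀ ρ ∈ E.J, ∀ s : T,
    (E.stationaryLaw ρ).map (fun (η : T → Config) (t : T) => η (t + s)) = E.stationaryLaw ρ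

/-- The laws `μ_ρ` are invariant under the translations of `ℤ`. -/
def TranslationInvariant : Prop :=
  ∀ ρ ∈ E.J, ∀ x : ℤ, (E.μ ρ).map (fun (η : Config) (y : ℤ) => η (x + y)) = E.μ ρ

/-- Monotonicity, quenched and annealed. The order of the quantifiers over times and realisations is
immaterial when `T` is countable; it is the less demanding one when `T` is uncountable. -/
def Monotonicity : Prop :=
  (∀ η₀' η₀ : Config, η₀' ≤ η₀ →
    ∃ Q : Measure ((T → Config) × (T → Config)), IsCoupling Q (E.law η₀') (E.law η₀) ∧
      ∀ t : T, ∀ᵐ q ∂Q, q.1 t ≤ q.2 t) ∧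
  (∀ ρ' ∈ E.J, ∀ ρ ∈ E.J, ρ' ≤ ρ →
    ∃ Q : Measure (Config × Config), IsCoupling Q (E.μ ρ') (E.μ ρ) ∧ ∀ᵐ q ∂Q, q.1 ≤ q.2)

/-- Density at stationarity. -/
def DensityAtStationarity : Prop :=
  ∃ c : ℝ, 0 < c ∧ ∀ ρ ∈ E.J, ∀ ε ∈ Set.Ioo (0 : ℝ) 1, ∀ l : ℕ, 1 ≤ l →
    (E.stationaryLaw ρ).real {η | ε * l ≤ |(count (η 0) 0 ((l : ℤ) - 1) : ℝ) - ρ * l|} ≤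
      2 * Real.exp (-c * ε ^ 2 * l)

/-- No particle drifting in from the side, at activity rate `ν`. Here `q.1` is `η` and `q.2` is `η'`,
and `[0, t]` and `[-H + 2νkt, H - 2νkt]` are sets of integers. -/
def NoDriftFromSide (ν : ℝ) : Prop :=
  ∀ t H k : ℕ, 1 ≤ k → ∀ η₀ η₀' : Config,
    (∀ x : ℤ, -(H : ℤ) ≤ x → x ≤ H → η₀' x ≤ η₀ x) →
    ∃ Q : Measure ((T → Config) × (T → Config)), IsCoupling Q (E.law η₀) (E.law η₀') ∧
      1 - 20 * Real.exp (-(k * ν * t) / 4) ≤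
        Q.real {q | ∀ s : ℕ, s ≤ t → ∀ x : ℤ,
          -(H : ℝ) + 2 * ν * k * t ≤ x → (x : ℝ) ≤ H - 2 * ν * k * t →
            q.2 (s : T) x ≤ q.1 (s : T) x}

/-- Covering `η'` by `η`, at activity rate `ν`. Here `q.1` is `η` and `q.2` is `η'`, and `[a, b]` is
an interval of integers, of length `b - a + 1`. -/
def Covering (ν : ℝ) : Prop :=
  ∃ C C' : ℝ, 0 < C ∧ 0 < C' ∧
    ∀ ρ ∈ E.J, ∀ ε ∈ Set.Ioo (0 : ℝ) 1, ρ + ε ∈ E.J →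
    ∀ H t : ℕ, 1 ≤ H → 1 ≤ t →
    4 * ν * t < H → 1 < ν ^ 8 * t →
    C * ε⁻¹ ^ 2 * (1 + |Real.log (ν * t) ^ 3|) < ν * (t : ℝ) ^ (1 / 4 : ℝ) →
    ∀ l : ℕ, l = ⌊(t : ℝ) ^ (1 / 4 : ℝ)⌋₊ →
    ∀ η₀ η₀' : Config,
    (∀ a b : ℤ, -(H : ℤ) ≤ a → a ≤ b → b ≤ H →
      ((l / 2 : ℕ) : ℤ) ≤ b - a + 1 → b - a + 1 ≤ (l : ℤ) →
        (ρ + 3 * ε / 4) * ((b - a + 1 : ℤ) : ℝ) ≤ (count η₀ a b : ℝ) ∧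
        (count η₀' a b : ℝ) ≤ (ρ + ε / 4) * ((b - a + 1 : ℤ) : ℝ)) →
    ∃ Q : Measure ((T → Config) × (T → Config)), IsCoupling Q (E.law η₀) (E.law η₀') ∧
      1 - C' * t * H * Real.exp (-(C' * (1 + ν⁻¹))⁻¹ * ε ^ 2 * (t : ℝ) ^ (1 / 4 : ℝ)) ≤
        Q.real {q | ∀ x : ℤ, -(H : ℝ) + 4 * ν * t ≤ x → (x : ℝ) ≤ H - 4 * ν * t →
          q.2 (t : T) x ≤ q.1 (t : T) x}

end conditions

section speed

variable {T : Type*} [CommSemiring T] [LinearOrder T] [Sub T] [FloorSemiring T]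
  (E : RandomEnvironment T)

/-- The law `𝐏^{ρ,L}` of the environment of range `L`, for `L ≥ 1`: the environments on the time
blocks `[kL, (k + 1)L)` are independent, and each is distributed as `(η_s)_{0 ≤ s < L}` under `𝐏^ρ`;
in particular the configuration is sampled afresh from `μ_ρ` at every multiple of `L`. -/
def finiteRangeLaw (ρ : ℝ) (L : ℕ) : Measure (T → Config) :=
  (Measure.infinitePi fun _ : ℕ => E.stationaryLaw ρ).map
    fun (ω : ℕ → T → Config) (t : T) => ω (⌊t⌋₊ / L) (t - ((⌊t⌋₊ / L * L : ℕ) : T))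

/-- `v(ρ, L) = 𝔼^{ρ,L}[X_L / L]`, the speed of the walk in the environment of range `L`. -/
def rangeSpeed (pEmpty pOcc ρ : ℝ) (L : ℕ) : ℝ :=
  ∫ X : ℕ → ℤ, (X L : ℝ) / L ∂(annealedLaw pEmpty pOcc (E.finiteRangeLaw ρ L))

/-- The set of the densities `ρ ∈ J` at which `v(ρ) = lim_L v(ρ, L)` exists. -/
def Jbar (pEmpty pOcc : ℝ) : Set ℝ :=
  {ρ | ρ ∈ E.J ∧ ∃ w : ℝ, Tendsto (fun L : ℕ => E.rangeSpeed pEmpty pOcc ρ L) atTop (𝓝 w)}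

/-- `v(ρ) = lim_L v(ρ, L)`, which is meaningful for `ρ` in `Jbar`. -/
def speed (pEmpty pOcc ρ : ℝ) : ℝ :=
  limUnder atTop fun L : ℕ => E.rangeSpeed pEmpty pOcc ρ L

end speed

end RandomEnvironment

end

open MeasureTheory ProbabilityTheory Filter Topology

noncomputable section

set_option linter.unusedSectionVars false

/-! Only the first time block enters `v(ρ, L)`, so `L v(ρ, L)` is the mean position at time `L` in
the stationary environment (`rangeSpeed_eq`). The core is a comparison of two scales: at density `ρ
+ δ` and up to a time `M` much larger than `L`, the walk is at least as fast as at density `ρ` up to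
time `L`, up to a small error.

Cut `[0, M)` into blocks of length `t + L` with `t` about `√L`. The law of the environment seen from
the walker at the start of a block is unknown. Seen from a fixed site, however, it is `μ_{ρ+δ}`, so
all its densities at scale `t^{1/4}` are close to `ρ + δ`, except with a probability exponentially
small in a power of `t`. A union bound over the sites that the walker can occupy (at most `2M + 1`)
is affordable as long as `M` is polynomial in `L` (`integral_walkMean_add_ge`).

From such a typical configuration, the first `t` steps of the block let the environment dominate, on
a window, one started at density `ρ` (`Covering`). Meanwhile the walker is at worst at distance `t`
to the left, and by monotonicity it may be restarted from there. During the next `L` steps the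
domination persists around the walker (`NoDriftFromSide`). The walk is monotone in the environment
and, within a parity class, in its starting point (`walkMean_mono`), so the block contributes at
least `L v(ρ, L) - t` minus an error (`meanDisplacement_ge_of_isTypical`). Averaging over the blocks
gives `v(ρ, L) ≤ v(ρ + δ, M) + L^{-1/32}` for `δ ≥ L^{-1/32}` and `L² ≤ M ≤ L⁴`
(`exists_rangeSpeed_le_of_le_pow`).

Along `L, L², L⁴, …` the density increments and the errors sum to at most `3 L^{-1/32}`, which
covers every `M ≥ L²` (`exists_rangeSpeed_le`). Letting `M → ∞` and then `L → ∞` gives the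
inequality. It makes the open intervals from liminf to limsup at distinct densities disjoint, so
only countably many are non-empty. -/

/-- The probability of a jump to the right from a site with `k` particles. -/
def jumpProb (pEmpty pOcc : ℝ) (k : ℕ) : ℝ := if k = 0 then pEmpty else pOcc

/-- The mean of `f (Xₙ)` for the walk started from `y` in the fixed environment `e`. -/
def walkMean (pEmpty pOcc : ℝ) : ℕ → (ℕ → Config) → (ℤ → ℝ) → ℤ → ℝ
  | 0, _, f, y => f y
  | n + 1, e, f, y =>
    jumpProb pEmpty pOcc (e 0 y) * walkMean pEmpty pOcc n (fun k => e (k + 1)) f (y + 1) +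
      (1 - jumpProb pEmpty pOcc (e 0 y)) * walkMean pEmpty pOcc n (fun k => e (k + 1)) f (y - 1)

/-! ### The walk in a fixed environment -/

section walkMean

variable {pEmpty pOcc : ℝ}

lemma jumpProb_nonneg (hp0 : 0 ≤ pEmpty) (hp : pEmpty < pOcc) (k : ℕ) :
    0 ≤ jumpProb pEmpty pOcc k := by
  unfold jumpProb; split_ifs <;> linarith

lemma jumpProb_le_one (hp : pEmpty < pOcc) (hp1 : pOcc ≤ 1) (k : ℕ) :
    jumpProb pEmpty pOcc k ≤ 1 := by
  unfold jumpProb; split_ifs <;> linarith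

lemma jumpProb_mono (hp : pEmpty < pOcc) : Monotone (jumpProb pEmpty pOcc) := by
  intro k l hkl
  unfold jumpProb
  split_ifs with h1 h2
  · exact le_rfl
  · exact hp.le
  · omega
  · exact le_rfl

/-- Markov property of the walk in a fixed environment. -/
lemma walkMean_add (n m : ℕ) (e : ℕ → Config) (f : ℤ → ℝ) (y : ℤ) :
    walkMean pEmpty pOcc (n + m) e f y =
      walkMean pEmpty pOcc n e (walkMean pEmpty pOcc m (fun k => e (n + k)) f) y := by
  induction n generalizing e y with
  | zero => simp [walkMean]
  | succ n ih =>
    have h : (fun k => e (n + 1 + k)) = fun k => e (n + k + 1) := by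
      funext k; congr 1; omega
    rw [Nat.succ_add, walkMean, walkMean, ih, ih, h]

lemma walkMean_const (n : ℕ) (e : ℕ → Config) (c : ℝ) (y : ℤ) :
    walkMean pEmpty pOcc n e (fun _ => c) y = c := by
  induction n generalizing e y with
  | zero => rfl
  | succ n ih => rw [walkMean, ih, ih]; ring

lemma walkMean_sum {ι : Type*} (s : Finset ι) (a : ι → ℝ) (g : ι → ℤ → ℝ)
    (n : ℕ) (e : ℕ → Config) (y : ℤ) :
    walkMean pEmpty pOcc n e (fun x => ∑ i ∈ s, a i * g i x) y =
      ∑ i ∈ s, a i * walkMean pEmpty pOcc n e (g i) y := by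
  induction n generalizing e y with
  | zero => rfl
  | succ n ih =>
    simp only [walkMean]
    rw [ih, ih, Finset.mul_sum, Finset.mul_sum, ← Finset.sum_add_distrib]
    exact Finset.sum_congr rfl fun i _ => by ring

lemma walkMean_const_add (c : ℝ) (f : ℤ → ℝ) (n : ℕ) (e : ℕ → Config) (y : ℤ) :
    walkMean pEmpty pOcc n e (fun x => c + f x) y = c + walkMean pEmpty pOcc n e f y := by
  induction n generalizing e y with
  | zero => rfl
  | succ n ih => rw [walkMean, ih, ih, walkMean]; ring

lemma walkMean_translate (x : ℤ) (f : ℤ → ℝ) (n : ℕ) (e : ℕ → Config) (y : ℤ) :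
    walkMean pEmpty pOcc n e f (x + y) =
      walkMean pEmpty pOcc n (fun k z => e k (x + z)) (fun z => f (x + z)) y := by
  induction n generalizing e y with
  | zero => rfl
  | succ n ih =>
    simp only [walkMean]
    rw [add_assoc, ih, add_sub_assoc, ih]

lemma walkMean_congr_env {n : ℕ} {e e' : ℕ → Config} (h : ∀ k < n, e k = e' k) (f : ℤ → ℝ)
    (y : ℤ) : walkMean pEmpty pOcc n e f y = walkMean pEmpty pOcc n e' f y := by
  induction n generalizing e e' y with
  | zero => rfl
  | succ n ih =>
    have h' : ∀ k < n, e (k + 1) = e' (k + 1) := fun k hk => h _ (by omega)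
    rw [walkMean, walkMean, ih h', ih h', h 0 (by omega)]

lemma measurable_walkMean (n : ℕ) (f : ℤ → ℝ) (y : ℤ) :
    Measurable fun e : ℕ → Config => walkMean pEmpty pOcc n e f y := by
  induction n generalizing y with
  | zero => exact measurable_const
  | succ n ih =>
    have hs : Measurable fun (e : ℕ → Config) (k : ℕ) => e (k + 1) :=
      measurable_pi_lambda _ fun k => measurable_pi_apply _
    have hq : Measurable fun e : ℕ → Config => jumpProb pEmpty pOcc (e 0 y) :=
      (measurable_from_top (f := jumpProb pEmpty pOcc)).comp
        ((measurable_pi_apply y).comp (measurable_pi_apply 0))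
    exact (hq.mul ((ih (y + 1)).comp hs)).add
      ((measurable_const.sub hq).mul ((ih (y - 1)).comp hs))

/-- The walk moves at most `n` in `n` steps, so values further away are irrelevant; this allows
unbounded test functions such as the identity. -/
lemma walkMean_le_walkMean (hp0 : 0 ≤ pEmpty) (hp : pEmpty < pOcc) (hp1 : pOcc ≤ 1)
    {n : ℕ} {y : ℤ} {f g : ℤ → ℝ}
    (h : ∀ x, |x - y| ≤ n → f x ≤ g x) (e : ℕ → Config) :
    walkMean pEmpty pOcc n e f y ≤ walkMean pEmpty pOcc n e g y := by
  induction n generalizing e y with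
  | zero => exact h y (by simp)
  | succ n ih =>
    have h1 := ih (y := y + 1) (fun x hx => h x (by push_cast; rw [abs_le] at *; omega))
      (fun k => e (k + 1))
    have h2 := ih (y := y - 1) (fun x hx => h x (by push_cast; rw [abs_le] at *; omega))
      (fun k => e (k + 1))
    exact add_le_add (mul_le_mul_of_nonneg_left h1 (jumpProb_nonneg hp0 hp _))
      (mul_le_mul_of_nonneg_left h2 (sub_nonneg.2 (jumpProb_le_one hp hp1 _)))

lemma walkMean_congr (hp0 : 0 ≤ pEmpty) (hp : pEmpty < pOcc) (hp1 : pOcc ≤ 1)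
    {n : ℕ} {y : ℤ} {f g : ℤ → ℝ}
    (h : ∀ x, |x - y| ≤ n → f x = g x) (e : ℕ → Config) :
    walkMean pEmpty pOcc n e f y = walkMean pEmpty pOcc n e g y :=
  le_antisymm (walkMean_le_walkMean hp0 hp hp1 (fun x hx => (h x hx).le) e)
    (walkMean_le_walkMean hp0 hp hp1 (fun x hx => (h x hx).ge) e)

/-- The mean of `f (Xₙ)` in terms of the distribution of `Xₙ`. -/
lemma walkMean_eq_sum (hp0 : 0 ≤ pEmpty) (hp : pEmpty < pOcc) (hp1 : pOcc ≤ 1)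
    (n : ℕ) (e : ℕ → Config) (f : ℤ → ℝ) :
    walkMean pEmpty pOcc n e f 0 = ∑ x ∈ Finset.Icc (-(n : ℤ)) n,
      f x * walkMean pEmpty pOcc n e (fun z => if z = x then 1 else 0) 0 := by
  rw [← walkMean_sum]
  refine walkMean_congr hp0 hp hp1 (fun x hx => ?_) e
  rw [sub_zero, abs_le] at hx
  simp [Finset.sum_ite_eq, hx]

lemma walkMean_indicator_nonneg (hp0 : 0 ≤ pEmpty) (hp : pEmpty < pOcc) (hp1 : pOcc ≤ 1)
    (n : ℕ) (e : ℕ → Config) (x y : ℤ) :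
    0 ≤ walkMean pEmpty pOcc n e (fun z => if z = x then 1 else 0) y := by
  refine (walkMean_const (pEmpty := pEmpty) (pOcc := pOcc) n e 0 y).ge.trans ?_
  exact walkMean_le_walkMean hp0 hp hp1 (fun z _ => by split_ifs <;> norm_num) e

lemma walkMean_indicator_le_one (hp0 : 0 ≤ pEmpty) (hp : pEmpty < pOcc) (hp1 : pOcc ≤ 1)
    (n : ℕ) (e : ℕ → Config) (x y : ℤ) :
    walkMean pEmpty pOcc n e (fun z => if z = x then 1 else 0) y ≤ 1 := by
  refine le_trans ?_ (walkMean_const (pEmpty := pEmpty) (pOcc := pOcc) n e 1 y).le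
  exact walkMean_le_walkMean hp0 hp hp1 (fun z _ => by split_ifs <;> norm_num) e

lemma abs_walkMean_intCast_le (hp0 : 0 ≤ pEmpty) (hp : pEmpty < pOcc) (hp1 : pOcc ≤ 1)
    (n : ℕ) (e : ℕ → Config) :
    |walkMean pEmpty pOcc n e (fun x => (x : ℝ)) 0| ≤ n := by
  rw [abs_le]
  constructor
  · rw [← walkMean_const (pEmpty := pEmpty) (pOcc := pOcc) n e (-(n : ℝ)) 0]
    refine walkMean_le_walkMean hp0 hp hp1 (fun x hx => ?_) e
    rw [sub_zero, abs_le] at hx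
    exact_mod_cast hx.1
  · conv_rhs => rw [← walkMean_const (pEmpty := pEmpty) (pOcc := pOcc) n e (n : ℝ) 0]
    refine walkMean_le_walkMean hp0 hp hp1 (fun x hx => ?_) e
    rw [sub_zero, abs_le] at hx
    exact_mod_cast hx.2

/-- The walk is monotone in its starting point (within a parity class) and in the environment. -/
lemma walkMean_mono (hp0 : 0 ≤ pEmpty) (hp : pEmpty < pOcc) (hp1 : pOcc ≤ 1)
    {f : ℤ → ℝ} (hf : Monotone f) {N : ℤ} {n : ℕ} {e e' : ℕ → Config}
    (he : ∀ k < n, ∀ x : ℤ, |x| ≤ N → e' k x ≤ e k x) {y' : ℤ} (hN : |y'| + n ≤ N) (j : ℕ) :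
    walkMean pEmpty pOcc n e' f y' ≤ walkMean pEmpty pOcc n e f (y' + 2 * j) := by
  induction n generalizing e e' y' j with
  | zero => exact hf (by omega)
  | succ n ih =>
    have he1 : ∀ k < n, ∀ x : ℤ, |x| ≤ N → e' (k + 1) x ≤ e (k + 1) x :=
      fun k hk x hx => he _ (by omega) x hx
    have hu : |y' + 1| + (n : ℤ) ≤ N := by
      have := abs_add_le y' 1; push_cast at hN; simp at this; omega
    have hd : |y' - 1| + (n : ℤ) ≤ N := by
      have := abs_sub y' 1; push_cast at hN; simp at this; omega
    have hy : |y'| ≤ N := by push_cast at hN; omega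
    simp only [walkMean]
    set q := jumpProb pEmpty pOcc (e 0 (y' + 2 * j))
    set q' := jumpProb pEmpty pOcc (e' 0 y')
    have q0 : 0 ≤ q := jumpProb_nonneg hp0 hp _
    have q0' : 0 ≤ q' := jumpProb_nonneg hp0 hp _
    have q1 : q ≤ 1 := jumpProb_le_one hp hp1 _
    have q1' : q' ≤ 1 := jumpProb_le_one hp hp1 _
    have AC := ih he1 hu j
    have BD := ih he1 hd j
    rw [show y' + 1 + 2 * (j : ℤ) = y' + 2 * j + 1 by ring] at AC
    rw [show y' - 1 + 2 * (j : ℤ) = y' + 2 * j - 1 by ring] at BD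
    -- At equal positions the order of the environments orders the jump probabilities. At distance
    -- at least 2 every pair of jumps preserves the order, so independent jumps suffice and the
    -- environments are not compared. Hence only the range of the lower walk has to lie in `[-N,
    -- N]`.
    rcases j with _ | j
    · have DC := ih (e := fun k => e (k + 1)) (e' := fun k => e (k + 1))
        (fun _ _ _ _ => le_rfl) hd 1
      rw [show y' - 1 + 2 * ((1 : ℕ) : ℤ) = y' + 2 * ((0 : ℕ) : ℤ) + 1 by push_cast; ring,
        show y' - 1 = y' + 2 * ((0 : ℕ) : ℤ) - 1 by push_cast; ring] at DC
      have hq : q' ≤ q := by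
        refine jumpProb_mono hp ?_
        simpa using he 0 (by omega) y' hy
      nlinarith [mul_le_mul_of_nonneg_left AC q0', mul_le_mul_of_nonneg_left BD (sub_nonneg.2 q1'),
        mul_nonneg (sub_nonneg.2 hq) (sub_nonneg.2 DC)]
    · have BC := ih he1 hd (j + 1 + 1)
      have AD := ih he1 hu j
      rw [show y' - 1 + 2 * ((j + 1 + 1 : ℕ) : ℤ) = y' + 2 * ((j + 1 : ℕ) : ℤ) + 1 by
        push_cast; ring] at BC
      rw [show y' + 1 + 2 * (j : ℤ) = y' + 2 * ((j + 1 : ℕ) : ℤ) - 1 by push_cast; ring] at AD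
      have r1 := sub_nonneg.2 q1
      have r1' := sub_nonneg.2 q1'
      nlinarith [mul_nonneg (mul_nonneg q0 q0') (sub_nonneg.2 AC),
        mul_nonneg (mul_nonneg r1 q0') (sub_nonneg.2 AD),
        mul_nonneg (mul_nonneg q0 r1') (sub_nonneg.2 BC),
        mul_nonneg (mul_nonneg r1 r1') (sub_nonneg.2 BD)]

/-- The reachable positions are `y - n, y - n + 2, …`, so monotonicity along steps of length 2 is
enough, and it is all that `walkMean_mono` provides. -/
lemma le_walkMean_of_le_add_two (hp0 : 0 ≤ pEmpty) (hp : pEmpty < pOcc) (hp1 : pOcc ≤ 1)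
    {g : ℤ → ℝ} (hg : ∀ x, g x ≤ g (x + 2)) (n : ℕ)
    (e : ℕ → Config) (y : ℤ) : g (y - n) ≤ walkMean pEmpty pOcc n e g y := by
  induction n generalizing e y with
  | zero => simp [walkMean]
  | succ n ih =>
    have h1 := ih (fun k => e (k + 1)) (y + 1)
    have h2 := ih (fun k => e (k + 1)) (y - 1)
    have h3 := hg (y - 1 - n)
    rw [show y - 1 - (n : ℤ) + 2 = y + 1 - n by ring] at h3
    rw [show y - ((n + 1 : ℕ) : ℤ) = y - 1 - n by push_cast; ring, walkMean]
    nlinarith [jumpProb_nonneg hp0 hp (e 0 y), jumpProb_le_one hp hp1 (e 0 y),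
      mul_le_mul_of_nonneg_left (h3.trans h1) (jumpProb_nonneg hp0 hp (e 0 y)),
      mul_le_mul_of_nonneg_left h2 (sub_nonneg.2 (jumpProb_le_one hp hp1 (e 0 y)))]

/-- The walk is at least the walk that is restarted after `n` steps from the leftmost position. -/
lemma walkMean_restart_le (hp0 : 0 ≤ pEmpty) (hp : pEmpty < pOcc) (hp1 : pOcc ≤ 1)
    {f : ℤ → ℝ} (hf : Monotone f) (n m : ℕ) (e : ℕ → Config) (y : ℤ) :
    walkMean pEmpty pOcc m (fun k => e (n + k)) f (y - n) ≤
      walkMean pEmpty pOcc (n + m) e f y := by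
  rw [walkMean_add]
  refine le_walkMean_of_le_add_two hp0 hp hp1 (fun x => ?_) n e y
  simpa using walkMean_mono hp0 hp hp1 hf (e := fun k => e (n + k)) (e' := fun k => e (n + k))
    (fun _ _ _ _ => le_rfl) (le_refl (|x| + (m : ℤ))) 1

end walkMean

/-! ### The walk driven by uniform variables -/

section walk

variable {T : Type*} [NatCast T] {pEmpty pOcc : ℝ}

/-- The configurations of `η` at integer times. -/
def integerPath (η : T → Config) : ℕ → Config := fun n => η n

lemma measurable_integerPath : Measurable (integerPath : (T → Config) → ℕ → Config) :=
  measurable_pi_lambda _ fun _ => measurable_pi_apply _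

lemma measurable_walkMean_integerPath (n : ℕ) (f : ℤ → ℝ) (y : ℤ) :
    Measurable fun η : T → Config => walkMean pEmpty pOcc n (integerPath η) f y :=
  (measurable_walkMean n f y).comp measurable_integerPath

lemma walk_congr {n : ℕ} {u v : ℕ → unitInterval} (η : T → Config) (h : ∀ k < n, u k = v k) :
    walk pEmpty pOcc η u n = walk pEmpty pOcc η v n := by
  induction n with
  | zero => rfl
  | succ n ih => simp only [walk]; rw [ih fun k hk => h k (by omega), h n (by omega)]

lemma abs_walk_le (η : T → Config) (u : ℕ → unitInterval) (n : ℕ) :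
    |walk pEmpty pOcc η u n| ≤ n := by
  induction n with
  | zero => simp [walk]
  | succ n ih =>
    simp only [walk]
    rw [abs_le] at *
    push_cast
    split_ifs <;> omega

lemma measurable_walk (η : T → Config) : Measurable (walk pEmpty pOcc η) :=
  (measurable_walk_joint pEmpty pOcc).comp measurable_prodMk_left

lemma indepFun_walk_next (η : T → Config) (n : ℕ) :
    IndepFun (fun u => walk pEmpty pOcc η u n) (fun u : ℕ → unitInterval => u n)
      uniformSeqLaw := by
  have hind : iIndepFun (fun (i : ℕ) (u : ℕ → unitInterval) => u i) uniformSeqLaw :=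
    iIndepFun_infinitePi (X := fun _ x => x) (by fun_prop)
  have h := hind.indepFun_finset (Finset.range n) {n} (by simp)
    (fun i => measurable_pi_apply i)
  -- Variables of index at least `n` do not affect the position at time `n`, so the value 0 given to
  -- them is immaterial.
  have hg : Measurable fun v : Finset.range n → unitInterval =>
      walk pEmpty pOcc η (fun k => if h : k ∈ Finset.range n then v ⟨k, h⟩ else 0) n := by
    refine (measurable_pi_apply n).comp ((measurable_walk η).comp
      (measurable_pi_lambda _ fun k => ?_))
    split_ifs
    · exact measurable_pi_apply _
    · exact measurable_const
  have hw : Measurable fun v : ({n} : Finset ℕ) → unitInterval => v ⟨n, by simp⟩ :=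
    measurable_pi_apply _
  refine (h.comp hg hw).congr (Eventually.of_forall fun u => ?_) (Eventually.of_forall fun u => rfl)
  exact walk_congr η fun k hk => by simp [hk]

lemma integral_ite_unitInterval_le {q : ℝ} (hq0 : 0 ≤ q) (hq1 : q ≤ 1) (a b : ℝ) :
    ∫ v : unitInterval, (if (v : ℝ) ≤ q then a else b) = q * a + (1 - q) * b := by
  have h : (fun v : unitInterval => if (v : ℝ) ≤ q then a else b) =
      fun v => (Set.Iic (⟨q, hq0, hq1⟩ : unitInterval)).indicator (fun _ => a - b) v + b := by
    funext v
    by_cases hv : (v : ℝ) ≤ q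
    · have : v ∈ Set.Iic (⟨q, hq0, hq1⟩ : unitInterval) := hv
      simp [hv, this]
    · have : v ∉ Set.Iic (⟨q, hq0, hq1⟩ : unitInterval) := hv
      simp [hv, this]
  rw [h, integral_add ((integrable_const _).indicator measurableSet_Iic) (integrable_const _),
    integral_indicator_const _ measurableSet_Iic, measureReal_def, unitInterval.volume_Iic]
  simp [ENNReal.toReal_ofReal hq0]
  ring

/-- The walk is built by appending a last step, whereas `walkMean` peels off the first one. The
induction integrates out the last, independent uniform variable and matches the two through
`walkMean_add`. -/
lemma integral_comp_walk (hp0 : 0 ≤ pEmpty) (hp : pEmpty < pOcc) (hp1 : pOcc ≤ 1)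
    (η : T → Config) (n : ℕ) {f : ℤ → ℝ} {C : ℝ} (hf : ∀ x, |f x| ≤ C) :
    ∫ u, f (walk pEmpty pOcc η u n) ∂uniformSeqLaw =
      walkMean pEmpty pOcc n (integerPath η) f 0 := by
  induction n generalizing f with
  | zero => simp [walk, walkMean]
  | succ n ih =>
    set q : ℤ → ℝ := fun x => jumpProb pEmpty pOcc (integerPath η n x) with hq
    have q0 : ∀ x, 0 ≤ q x := fun x => jumpProb_nonneg hp0 hp _
    have q1 : ∀ x, q x ≤ 1 := fun x => jumpProb_le_one hp hp1 _
    set G : ℤ × unitInterval → ℝ :=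
      fun r => if (r.2 : ℝ) ≤ q r.1 then f (r.1 + 1) else f (r.1 - 1) with hG
    have hGm : Measurable G := by
      refine Measurable.ite (measurableSet_le (by fun_prop) ?_) ?_ ?_
      · exact (measurable_from_top (f := q)).comp measurable_fst
      · exact (measurable_from_top (f := fun x => f (x + 1))).comp measurable_fst
      · exact (measurable_from_top (f := fun x => f (x - 1))).comp measurable_fst
    have hGb : ∀ r, ‖G r‖ ≤ C := fun r => by
      simp only [hG]; split_ifs <;> exact hf _
    have hX : Measurable fun u => walk pEmpty pOcc η u n :=
      (measurable_pi_apply n).comp (measurable_walk η)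
    have hU : Measurable fun u : ℕ → unitInterval => u n := measurable_pi_apply n
    have hmap := (indepFun_iff_map_prod_eq_prod_map_map hX.aemeasurable hU.aemeasurable).1
      (indepFun_walk_next (pEmpty := pEmpty) (pOcc := pOcc) η n)
    have hvol : uniformSeqLaw.map (fun u : ℕ → unitInterval => u n) = volume :=
      Measure.infinitePi_map_eval (fun _ : ℕ => (volume : Measure unitInterval)) n
    rw [hvol] at hmap
    have : IsProbabilityMeasure (uniformSeqLaw.map fun u => walk pEmpty pOcc η u n) :=
      Measure.isProbabilityMeasure_map hX.aemeasurable
    calc ∫ u, f (walk pEmpty pOcc η u (n + 1)) ∂uniformSeqLaw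
        = ∫ u, G (walk pEmpty pOcc η u n, u n) ∂uniformSeqLaw := by
          refine integral_congr_ae (Eventually.of_forall fun u => ?_)
          have hj : (pEmpty - pOcc) * (if η (n : T) (walk pEmpty pOcc η u n) = 0 then 1 else 0)
              + pOcc = q (walk pEmpty pOcc η u n) := by
            by_cases h0 : η (n : T) (walk pEmpty pOcc η u n) = 0 <;>
              simp [hq, jumpProb, integerPath, h0]
          simp only [walk, hG]
          rw [hj]
          split_ifs
          · congr 1; ring
          · congr 1; ring
      _ = ∫ r, G r ∂((uniformSeqLaw.map fun u => walk pEmpty pOcc η u n).prod volume) := by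
          rw [← hmap, integral_map (hX.prodMk hU).aemeasurable hGm.aestronglyMeasurable]
      _ = ∫ x, (q x * f (x + 1) + (1 - q x) * f (x - 1))
            ∂(uniformSeqLaw.map fun u => walk pEmpty pOcc η u n) := by
          rw [integral_prod _ (Integrable.of_bound hGm.aestronglyMeasurable C
            (Eventually.of_forall hGb))]
          exact integral_congr_ae (Eventually.of_forall fun x =>
            integral_ite_unitInterval_le (q0 x) (q1 x) (f (x + 1)) (f (x - 1)))
      _ = ∫ u, (fun x => q x * f (x + 1) + (1 - q x) * f (x - 1)) (walk pEmpty pOcc η u n)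
            ∂uniformSeqLaw := by
          rw [integral_map hX.aemeasurable measurable_from_top.aestronglyMeasurable]
      _ = walkMean pEmpty pOcc (n + 1) (integerPath η) f 0 := by
          rw [walkMean_add]
          refine ih (f := fun x => q x * f (x + 1) + (1 - q x) * f (x - 1)) fun x => ?_
          have h1 := abs_le.1 (hf (x + 1))
          have h2 := abs_le.1 (hf (x - 1))
          rw [abs_le]
          constructor <;> nlinarith [q0 x, q1 x]

lemma integral_walk (hp0 : 0 ≤ pEmpty) (hp : pEmpty < pOcc) (hp1 : pOcc ≤ 1)
    (η : T → Config) (n : ℕ) :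
    ∫ u, (walk pEmpty pOcc η u n : ℝ) ∂uniformSeqLaw =
      walkMean pEmpty pOcc n (integerPath η) (fun x => (x : ℝ)) 0 := by
  -- The preceding formula is for bounded functions; truncating the identity at `±n` changes
  -- nothing, because the walk is within `n` of 0 at time `n`.
  have hclamp : ∀ x : ℤ, |x| ≤ n → max (-(n : ℤ)) (min x n) = x := by
    intro x hx; rw [abs_le] at hx; omega
  have h := integral_comp_walk hp0 hp hp1 η n
    (f := fun x => ((max (-(n : ℤ)) (min x n) : ℤ) : ℝ)) (C := n) (fun x => by
      rw [abs_le]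
      have h1 : -(n : ℤ) ≤ max (-(n : ℤ)) (min x n) := by omega
      have h2 : max (-(n : ℤ)) (min x n) ≤ n := by omega
      exact ⟨by exact_mod_cast h1, by exact_mod_cast h2⟩)
  rw [walkMean_congr hp0 hp hp1 (g := fun x => (x : ℝ))
    (fun x hx => by rw [hclamp x (by simpa using hx)])] at h
  rw [← h]
  exact integral_congr_ae (Eventually.of_forall fun u => by
    simp only [hclamp _ (abs_walk_le η u n)])

lemma integral_annealedLaw (hp0 : 0 ≤ pEmpty) (hp : pEmpty < pOcc) (hp1 : pOcc ≤ 1)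
    (P : Measure (T → Config)) [IsProbabilityMeasure P] (n : ℕ) :
    ∫ X : ℕ → ℤ, (X n : ℝ) ∂(annealedLaw pEmpty pOcc P) =
      ∫ η, walkMean pEmpty pOcc n (integerPath η) (fun x => (x : ℝ)) 0 ∂P := by
  have hm := measurable_walk_joint (T := T) pEmpty pOcc
  have hlaw : annealedLaw pEmpty pOcc P =
      (P.prod uniformSeqLaw).map fun q => walk pEmpty pOcc q.1 q.2 := by
    ext s hs
    rw [annealedLaw, Measure.bind_apply hs (measurable_quenchedLaw pEmpty pOcc).aemeasurable,
      Measure.map_apply hm hs, Measure.prod_apply (hm hs)]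
    refine lintegral_congr fun η => ?_
    rw [quenchedLaw, Measure.map_apply (measurable_walk η) hs]
    rfl
  have hn : Measurable fun X : ℕ → ℤ => (X n : ℝ) :=
    (measurable_from_top (f := fun k : ℤ => (k : ℝ))).comp (measurable_pi_apply n)
  rw [hlaw, integral_map hm.aemeasurable hn.aestronglyMeasurable, integral_prod]
  · exact integral_congr_ae (Eventually.of_forall fun η => integral_walk hp0 hp hp1 η n)
  · refine Integrable.of_bound (hn.comp hm).aestronglyMeasurable n
      (Eventually.of_forall fun q => ?_)
    rw [Real.norm_eq_abs]
    exact_mod_cast abs_walk_le (pEmpty := pEmpty) (pOcc := pOcc) q.1 q.2 n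

end walk

/-! ### Markov property and stationarity of the environment -/

lemma integral_bind_kernel {α β : Type*} [MeasurableSpace α] [MeasurableSpace β] (μ : Measure α)
    [IsFiniteMeasure μ] (κ : Kernel α β) [IsMarkovKernel κ] {f : β → ℝ} (hf : Measurable f)
    {C : ℝ} (hC : ∀ b, |f b| ≤ C) :
    ∫ b, f b ∂(μ.bind κ) = ∫ a, ∫ b, f b ∂(κ a) ∂μ := by
  have h : Integrable f (μ.bind κ) :=
    Integrable.of_bound hf.aestronglyMeasurable C (Eventually.of_forall hC)
  rw [Measure.comp_eq_comp_const_apply] at h ⊢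
  rw [Kernel.integral_comp h]
  simp

namespace RandomEnvironment

variable {T : Type*} [CommSemiring T] [LinearOrder T] {E : RandomEnvironment T}

/-- The environment after time `s`, seen from `x`. -/
def shiftPath (s : T) (x : ℤ) (η : T → Config) : T → Config := fun t y => η (s + t) (x + y)

lemma measurable_shiftPath (s : T) (x : ℤ) :
    Measurable (shiftPath s x : (T → Config) → T → Config) :=
  measurable_pi_lambda _ fun t => measurable_pi_lambda _ fun y =>
    (measurable_pi_apply (x + y)).comp (measurable_pi_apply (s + t))

lemma measurable_translate (x : ℤ) : Measurable fun (ζ : Config) (y : ℤ) => ζ (x + y) :=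
  measurable_pi_lambda _ fun _ => measurable_pi_apply _

lemma measurable_eval_translate (s : T) (x : ℤ) :
    Measurable fun (η : T → Config) (y : ℤ) => η s (x + y) :=
  (measurable_translate x).comp (measurable_pi_apply s)

lemma past_le (s : T) : past s ≤ (MeasurableSpace.pi : MeasurableSpace (T → Config)) :=
  Measurable.comap_le (measurable_pi_lambda _ fun r => measurable_pi_apply r.1)

/-- The Markov property with respect to the kernel of `E`, for the law `P`. -/
def HasMarkovProperty (E : RandomEnvironment T) (P : Measure (T → Config)) : Prop :=
  ∀ (s : T) (x : ℤ) (A B : Set (T → Config)), MeasurableSet[past s] A → MeasurableSet B →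
    P (A ∩ shiftPath s x ⁻¹' B) = ∫⁻ η in A, E.law (fun y : ℤ => η s (x + y)) B ∂P

lemma MarkovInvariant.law (h : E.MarkovInvariant) (ζ : Config) :
    E.HasMarkovProperty (E.law ζ) := h.2 ζ

lemma measurable_law_translate (s : T) (x : ℤ) :
    Measurable fun η : T → Config => E.law fun y : ℤ => η s (x + y) :=
  E.law.measurable.comp (measurable_eval_translate s x)

/-- The transition kernel does not depend on the initial configuration, so the Markov property
survives mixing over it. -/
lemma MarkovInvariant.stationaryLaw (h : E.MarkovInvariant) (ρ : ℝ) :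
    E.HasMarkovProperty (E.stationaryLaw ρ) := by
  intro s x A B hA hB
  have hA' : MeasurableSet A := past_le s A hA
  have hm : Measurable fun η : T → Config => E.law (fun y : ℤ => η s (x + y)) B :=
    (Measure.measurable_coe hB).comp (measurable_law_translate s x)
  have hAB := hA'.inter (measurable_shiftPath s x hB)
  rw [RandomEnvironment.stationaryLaw, Measure.bind_apply hAB E.law.aemeasurable,
    ← lintegral_indicator hA', Measure.lintegral_bind E.law.aemeasurable
      (hm.indicator hA').aemeasurable]
  refine lintegral_congr fun ζ => ?_
  rw [lintegral_indicator hA']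
  exact h.2 ζ s x A B hA hB

/-- The functional form of the Markov property: `φ` will be the quenched probability that the walk
is at `x` at time `s`. -/
lemma HasMarkovProperty.integral_mul_comp_shiftPath {P : Measure (T → Config)}
    [IsProbabilityMeasure P] (h : E.HasMarkovProperty P) (s : T) (x : ℤ)
    {φ g : (T → Config) → ℝ} (hφ : Measurable[past s] φ) {c C : ℝ} (hc : ∀ η, |φ η| ≤ c)
    (hg : Measurable g) (hC : ∀ η, |g η| ≤ C) :
    ∫ η, φ η * g (shiftPath s x η) ∂P =
      ∫ η, φ η * ∫ ξ, g ξ ∂(E.law fun y : ℤ => η s (x + y)) ∂P := by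
  have hle := past_le (T := T) s
  set κ : Kernel (T → Config) (T → Config) :=
    ⟨fun η => E.law fun y : ℤ => η s (x + y), measurable_law_translate s x⟩ with hκ
  have : IsMarkovKernel κ := ⟨fun η => by
    change IsProbabilityMeasure (E.law _); infer_instance⟩
  set G : (T → Config) → ℝ := fun η => ∫ ξ, g ξ ∂(κ η) with hG
  have hGC : ∀ η, ‖G η‖ ≤ C := fun η => by
    have := norm_integral_le_of_norm_le_const (μ := κ η) (f := g) (Eventually.of_forall hC)
    simpa using this
  have hcfg : Measurable[past s] fun η : T → Config => fun y : ℤ => η s (x + y) := by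
    have h1 : Measurable[past s] fun (η : T → Config) (r : {r : T // r ≤ s}) => η r :=
      comap_measurable _
    exact ((measurable_translate x).comp (measurable_pi_apply (⟨s, le_rfl⟩ : {r : T // r ≤ s}))).comp
      h1
  have hGm : StronglyMeasurable[past s] G := by
    have h2 : StronglyMeasurable fun ζ : Config => ∫ ξ, g ξ ∂(E.law ζ) :=
      hg.stronglyMeasurable.integral_kernel
    exact h2.comp_measurable hcfg
  have hgs : Measurable fun η : T → Config => g (shiftPath s x η) :=
    hg.comp (measurable_shiftPath s x)
  have hgi : Integrable (fun η : T → Config => g (shiftPath s x η)) P :=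
    Integrable.of_bound hgs.aestronglyMeasurable C (Eventually.of_forall fun η => hC _)
  -- On each past event `A` the shifted path has law `(P.restrict A).bind κ`, which identifies `G`
  -- as the conditional expectation.
  have hcond : G =ᵐ[P] P[fun η => g (shiftPath s x η) | past s] := by
    refine ae_eq_condExp_of_forall_setIntegral_eq hle hgi (fun A _ _ => ?_) (fun A hA _ => ?_)
      hGm.aestronglyMeasurable
    · exact (Integrable.of_bound (hGm.mono hle).aestronglyMeasurable C
        (Eventually.of_forall hGC)).integrableOn
    · have hmeas : (P.restrict A).map (shiftPath s x) = (P.restrict A).bind κ := by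
        ext B hB
        rw [Measure.map_apply (measurable_shiftPath s x) hB,
          Measure.restrict_apply (measurable_shiftPath s x hB), Set.inter_comm,
          h s x A B hA hB, Measure.bind_apply hB κ.aemeasurable]
        rfl
      rw [← integral_map (measurable_shiftPath s x).aemeasurable hg.aestronglyMeasurable, hmeas,
        integral_bind_kernel _ κ hg hC]
  have hpull := condExp_stronglyMeasurable_mul_of_bound hle
    hφ.stronglyMeasurable hgi c (Eventually.of_forall hc)
  calc ∫ η, φ η * g (shiftPath s x η) ∂P
      = ∫ η, (P[φ * (fun η => g (shiftPath s x η)) | past s]) η ∂P :=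
        (integral_condExp hle).symm
    _ = ∫ η, φ η * G η ∂P := by
        refine integral_congr_ae ?_
        filter_upwards [hpull, hcond] with η h1 h2
        rw [h1, Pi.mul_apply, h2]

lemma law_map_eval_zero (h : E.MarkovInvariant) (ρ : ℝ) :
    (E.stationaryLaw ρ).map (fun η => η 0) = E.μ ρ := by
  ext s hs
  have hm : Measurable fun η : T → Config => η 0 := measurable_pi_apply 0
  rw [Measure.map_apply hm hs, stationaryLaw, Measure.bind_apply (hm hs) E.law.aemeasurable,
    ← lintegral_indicator_one hs]
  refine lintegral_congr fun ζ => ?_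
  by_cases hζ : ζ ∈ s
  · have : (fun η : T → Config => η 0) ⁻¹' s =ᵐ[E.law ζ] Set.univ := by
      filter_upwards [h.1 ζ] with η hη
      exact propext ⟨fun _ => trivial, fun _ => by change η 0 ∈ s; rwa [hη]⟩
    rw [measure_congr this]
    simp [hζ]
  · have : (fun η : T → Config => η 0) ⁻¹' s =ᵐ[E.law ζ] (∅ : Set (T → Config)) := by
      filter_upwards [h.1 ζ] with η hη
      exact propext ⟨fun hh => hζ (by change η 0 ∈ s at hh; rwa [hη] at hh), fun hh => hh.elim⟩
    rw [measure_congr this]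
    simp [hζ]

lemma stationaryLaw_map_eval (h : E.MarkovInvariant) (hS : E.Stationary) {ρ : ℝ} (hρ : ρ ∈ E.J)
    (s : T) : (E.stationaryLaw ρ).map (fun η => η s) = E.μ ρ := by
  have hm : Measurable fun (η : T → Config) (t : T) => η (t + s) :=
    measurable_pi_lambda _ fun t => measurable_pi_apply (t + s)
  rw [← law_map_eval_zero h ρ]
  conv_rhs => rw [← hS ρ hρ s, Measure.map_map (measurable_pi_apply 0) hm]
  congr 1
  funext η
  simp

/-- Under `𝐏^ρ`, the configuration seen from `x` at time `s` has law `μ_ρ`. -/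
lemma stationaryLaw_map_eval_translate (h : E.MarkovInvariant) (hS : E.Stationary)
    (hT : E.TranslationInvariant) {ρ : ℝ} (hρ : ρ ∈ E.J) (s : T) (x : ℤ) :
    (E.stationaryLaw ρ).map (fun η y => η s (x + y)) = E.μ ρ := by
  rw [← hT ρ hρ x]
  conv_rhs => rw [← stationaryLaw_map_eval h hS hρ s]
  rw [Measure.map_map (measurable_translate x) (measurable_pi_apply s)]
  rfl

/-- The mean displacement in `n` steps, for the environment started from `ζ`. -/
def meanDisplacement (E : RandomEnvironment T) (pEmpty pOcc : ℝ) (n : ℕ) (ζ : Config) : ℝ :=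
  ∫ η, walkMean pEmpty pOcc n (integerPath η) (fun x => (x : ℝ)) 0 ∂(E.law ζ)

variable {pEmpty pOcc : ℝ}

lemma measurable_meanDisplacement (n : ℕ) : Measurable (E.meanDisplacement pEmpty pOcc n) :=
  (measurable_walkMean_integerPath n _ 0).stronglyMeasurable.integral_kernel.measurable

section

lemma abs_meanDisplacement_le (hp0 : 0 ≤ pEmpty) (hp : pEmpty < pOcc) (hp1 : pOcc ≤ 1)
    (n : ℕ) (ζ : Config) :
    |E.meanDisplacement pEmpty pOcc n ζ| ≤ n := by
  have := norm_integral_le_of_norm_le_const (μ := E.law ζ)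
    (f := fun η => walkMean pEmpty pOcc n (integerPath η) (fun x => (x : ℝ)) 0)
    (Eventually.of_forall fun η => abs_walkMean_intCast_le hp0 hp hp1 n (integerPath η))
  simpa [meanDisplacement] using this

lemma integral_stationaryLaw_walkMean (hp0 : 0 ≤ pEmpty) (hp : pEmpty < pOcc) (hp1 : pOcc ≤ 1)
    (ρ : ℝ) (n : ℕ) :
    ∫ η, walkMean pEmpty pOcc n (integerPath η) (fun x => (x : ℝ)) 0 ∂(E.stationaryLaw ρ) =
      ∫ ζ, E.meanDisplacement pEmpty pOcc n ζ ∂(E.μ ρ) :=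
  integral_bind_kernel _ _ (measurable_walkMean_integerPath n _ 0)
    fun η => abs_walkMean_intCast_le hp0 hp hp1 n (integerPath η)

end

end RandomEnvironment

/-! ### The speed of range `L` as an average over one block -/

namespace RandomEnvironment

variable {T : Type*} [CommSemiring T] [LinearOrder T] [IsStrictOrderedRing T]
    [CanonicallyOrderedAdd T] [Sub T] [OrderedSub T] [FloorSemiring T]
    {E : RandomEnvironment T} {pEmpty pOcc : ℝ}

lemma measurable_concatenation (L : ℕ) : Measurable fun (ω : ℕ → T → Config) (t : T) =>
    ω (⌊t⌋₊ / L) (t - ((⌊t⌋₊ / L * L : ℕ) : T)) :=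
  measurable_pi_lambda _ fun _ => (measurable_pi_apply _).comp (measurable_pi_apply _)

lemma rangeSpeed_eq (hp0 : 0 ≤ pEmpty) (hp : pEmpty < pOcc) (hp1 : pOcc ≤ 1) (ρ : ℝ) (L : ℕ) :
    E.rangeSpeed pEmpty pOcc ρ L =
      (∫ η, walkMean pEmpty pOcc L (integerPath η) (fun x => (x : ℝ)) 0 ∂(E.stationaryLaw ρ))
        / L := by
  have hm := measurable_concatenation (T := T) L
  have : IsProbabilityMeasure (E.finiteRangeLaw ρ L) :=
    Measure.isProbabilityMeasure_map hm.aemeasurable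
  rw [rangeSpeed, integral_div, integral_annealedLaw hp0 hp hp1, finiteRangeLaw,
    integral_map hm.aemeasurable (measurable_walkMean_integerPath L _ 0).aestronglyMeasurable]
  congr 1
  conv_rhs => rw [← Measure.infinitePi_map_eval (fun _ : ℕ => E.stationaryLaw ρ) 0]
  rw [integral_map (measurable_pi_apply 0).aemeasurable
      (measurable_walkMean_integerPath L _ 0).aestronglyMeasurable]
  -- The first `L` steps read the environment at times below `L` only, all in block 0.
  refine integral_congr_ae (Eventually.of_forall fun ω => walkMean_congr_env (fun k hk => ?_) _ _)
  simp [integerPath, Nat.div_eq_of_lt hk]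

lemma abs_rangeSpeed_le (hp0 : 0 ≤ pEmpty) (hp : pEmpty < pOcc) (hp1 : pOcc ≤ 1) (ρ : ℝ)
    (L : ℕ) : |E.rangeSpeed pEmpty pOcc ρ L| ≤ 1 := by
  rw [rangeSpeed_eq hp0 hp hp1, abs_div, Nat.abs_cast]
  refine div_le_one_of_le₀ ?_ (Nat.cast_nonneg L)
  have := norm_integral_le_of_norm_le_const (μ := E.stationaryLaw ρ)
    (f := fun η => walkMean pEmpty pOcc L (integerPath η) (fun x => (x : ℝ)) 0)
    (Eventually.of_forall fun η => abs_walkMean_intCast_le hp0 hp hp1 L (integerPath η))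
  simpa using this

end RandomEnvironment

/-! ### Coupling estimates and typical configurations -/

/-- A function that is at most `B` off a set of measure at most `N` and exceeds `B` by at most `c`. -/
lemma integral_le_of_le_off {Ω : Type*} [MeasurableSpace Ω] {μ : Measure Ω} [IsProbabilityMeasure μ]
    {g : Ω → ℝ} (hg : Integrable g μ) {S : Set Ω} (hS : MeasurableSet S) {B c N : ℝ} (hc : 0 ≤ c)
    (hN : μ.real S ≤ N) (h1 : ∀ ω, ω ∉ S → g ω ≤ B) (h2 : ∀ ω, g ω ≤ B + c) :
    ∫ ω, g ω ∂μ ≤ B + c * N := by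
  have i : Integrable (S.indicator fun _ => c) μ := (integrable_const _).indicator hS
  have h : ∫ ω, g ω ∂μ ≤ ∫ ω, (B + S.indicator (fun _ => c) ω) ∂μ := by
    refine integral_mono hg ((integrable_const B).add i) fun ω => ?_
    by_cases hω : ω ∈ S
    · simpa [hω] using h2 ω
    · simpa [hω] using h1 ω hω
  rw [integral_add (integrable_const B) i, integral_indicator_const _ hS] at h
  simp only [integral_const, probReal_univ, smul_eq_mul] at h
  nlinarith [mul_le_mul_of_nonneg_left hN hc]

lemma IsCoupling.integral_le {Ω Ω' : Type*} [MeasurableSpace Ω] [MeasurableSpace Ω']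
    {Q : Measure (Ω × Ω')} {P : Measure Ω} {P' : Measure Ω'} [IsProbabilityMeasure P]
    (hQ : IsCoupling Q P P') {f : Ω → ℝ} {f' : Ω' → ℝ} (hf : Measurable f) (hf' : Measurable f')
    {a c q : ℝ} (ha : 0 ≤ a) (hc : 0 ≤ c) (hfc : ∀ ω, |f ω| ≤ c) (hfc' : ∀ ω, |f' ω| ≤ c)
    {G : Set (Ω × Ω')} (hG : 1 - q ≤ Q.real G) (hle : ∀ r ∈ G, f' r.2 ≤ f r.1 + a) :
    ∫ ω, f' ω ∂P' ≤ ∫ ω, f ω ∂P + a + 2 * c * q := by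
  have : IsProbabilityMeasure Q := ⟨by
    have h := congrArg (fun μ => μ Set.univ) hQ.1
    simpa [Measure.map_apply measurable_fst MeasurableSet.univ] using h⟩
  rw [← hQ.1, ← hQ.2, integral_map measurable_fst.aemeasurable hf.aestronglyMeasurable,
    integral_map measurable_snd.aemeasurable hf'.aestronglyMeasurable]
  -- The coupling event `G` is not assumed measurable; this measurable set contains it.
  set S : Set (Ω × Ω') := {r | f' r.2 ≤ f r.1 + a}
  have hS : MeasurableSet S :=
    measurableSet_le (hf'.comp measurable_snd) ((hf.comp measurable_fst).add_const a)
  have hGS : Q.real G ≤ Q.real S := measureReal_mono hle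
  have i1 : Integrable (fun r : Ω × Ω' => f r.1) Q :=
    Integrable.of_bound (hf.comp measurable_fst).aestronglyMeasurable c
      (Eventually.of_forall fun r => hfc _)
  have i2 : Integrable (fun r : Ω × Ω' => f' r.2) Q :=
    Integrable.of_bound (hf'.comp measurable_snd).aestronglyMeasurable c
      (Eventually.of_forall fun r => hfc' _)
  have h := integral_le_of_le_off (i2.sub i1) hS.compl (B := a) (c := 2 * c) (N := q)
    (by linarith) (by rw [probReal_compl_eq_one_sub hS]; linarith)
    (fun r hr => by
      have hr' : f' r.2 ≤ f r.1 + a := not_not.1 hr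
      simp only [Pi.sub_apply]; linarith)
    (fun r => by
      have h1 := (abs_le.1 (hfc r.1)).1
      have h2 := (abs_le.1 (hfc' r.2)).2
      simp only [Pi.sub_apply]; linarith)
  rw [integral_sub' i2 i1] at h
  linarith

lemma measurable_count (x y : ℤ) : Measurable fun ζ : Config => (count ζ x y : ℝ) := by
  have : Measurable fun ζ : Config => count ζ x y :=
    Finset.measurable_sum _ fun z _ => measurable_pi_apply z
  exact (measurable_from_top (f := fun k : ℕ => (k : ℝ))).comp this

lemma count_translate (ζ : Config) (x a b : ℤ) :
    count (fun y => ζ (x + y)) a b = count ζ (x + a) (x + b) := by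
  unfold count
  refine Finset.sum_bij (fun z _ => x + z) ?_ ?_ ?_ ?_
  · intro z hz; simp only [Finset.mem_Icc] at *; omega
  · intro z _ w _ h; omega
  · intro z hz
    simp only [Finset.mem_Icc] at hz
    exact ⟨z - x, by simp only [Finset.mem_Icc]; omega, by omega⟩
  · intro z _; rfl

/-- All the intervals in `[-H, H]` with length between `⌊l/2⌋` and `l` have an empirical density
within `ε` of `ρ`. -/
def IsTypical (H l : ℕ) (ρ ε : ℝ) (ζ : Config) : Prop :=
  ∀ a b : ℤ, -(H : ℤ) ≤ a → a ≤ b → b ≤ H → ((l / 2 : ℕ) : ℤ) ≤ b - a + 1 → b - a + 1 ≤ (l : ℤ) →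
    |(count ζ a b : ℝ) - ρ * ((b - a + 1 : ℤ) : ℝ)| < ε * ((b - a + 1 : ℤ) : ℝ)

lemma measurableSet_isTypical (H l : ℕ) (ρ ε : ℝ) : MeasurableSet {ζ | IsTypical H l ρ ε ζ} := by
  simp only [IsTypical, Set.ofPred_forall]
  refine MeasurableSet.iInter fun a => MeasurableSet.iInter fun b => MeasurableSet.iInter fun _ =>
    MeasurableSet.iInter fun _ => MeasurableSet.iInter fun _ => MeasurableSet.iInter fun _ =>
    MeasurableSet.iInter fun _ => measurableSet_lt ?_ measurable_const
  exact continuous_abs.measurable.comp ((measurable_count a b).sub_const _)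

namespace RandomEnvironment

variable {T : Type*} [CommSemiring T] [LinearOrder T] {E : RandomEnvironment T}
  {pEmpty pOcc : ℝ}

lemma measureReal_count_deviation_le (hM : E.MarkovInvariant) (hT : E.TranslationInvariant)
    {c ρ ε : ℝ} (hρ : ρ ∈ E.J)
    (hD : ∀ l : ℕ, 1 ≤ l → (E.stationaryLaw ρ).real
      {η | ε * l ≤ |(count (η 0) 0 ((l : ℤ) - 1) : ℝ) - ρ * l|} ≤ 2 * Real.exp (-c * ε ^ 2 * l))
    {a b : ℤ} (hab : a ≤ b) :
    (E.μ ρ).real {ζ | ε * ((b - a + 1 : ℤ) : ℝ) ≤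
      |(count ζ a b : ℝ) - ρ * ((b - a + 1 : ℤ) : ℝ)|} ≤
        2 * Real.exp (-c * ε ^ 2 * ((b - a + 1 : ℤ) : ℝ)) := by
  obtain ⟨n, hn⟩ := Int.eq_ofNat_of_zero_le (show 0 ≤ b - a + 1 by omega)
  have hn1 : 1 ≤ n := by omega
  have hb : b = a + ((n : ℤ) - 1) := by omega
  have hS : MeasurableSet {ζ : Config | ε * (n : ℝ) ≤
      |(count ζ 0 ((n : ℤ) - 1) : ℝ) - ρ * (n : ℝ)|} :=
    measurableSet_le measurable_const
      (continuous_abs.measurable.comp ((measurable_count _ _).sub_const _))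
  rw [hn, Int.cast_natCast]
  refine le_trans (le_of_eq ?_) (hD n hn1)
  have h1 := map_measureReal_apply (μ := E.stationaryLaw ρ) (measurable_pi_apply (0 : T)) hS
  rw [law_map_eval_zero hM] at h1
  have h2 := map_measureReal_apply (μ := E.μ ρ) (measurable_translate a) hS
  rw [hT ρ hρ a, h1] at h2
  simp only [Set.preimage_ofPred_eq, count_translate, add_zero] at h2
  rw [hb, ← h2]

/-- Union bound over the `(2H + 1)²` pairs of endpoints. -/
lemma measureReal_not_isTypical_le (hM : E.MarkovInvariant) (hT : E.TranslationInvariant)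
    {c ρ ε : ℝ} (hc : 0 < c) (hρ : ρ ∈ E.J)
    (hD : ∀ l : ℕ, 1 ≤ l → (E.stationaryLaw ρ).real
      {η | ε * l ≤ |(count (η 0) 0 ((l : ℤ) - 1) : ℝ) - ρ * l|} ≤ 2 * Real.exp (-c * ε ^ 2 * l))
    (H l : ℕ) :
    (E.μ ρ).real {ζ | ¬ IsTypical H l ρ ε ζ} ≤
      (2 * H + 1) ^ 2 * (2 * Real.exp (-c * ε ^ 2 * (l / 3))) := by
  set I := Finset.Icc (-(H : ℤ)) H
  have hI : (I.card : ℝ) = 2 * H + 1 := by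
    have : I.card = 2 * H + 1 := by simp [I]; omega
    rw [this]; push_cast; ring
  set B : ℤ × ℤ → Set Config := fun r => {ζ | r.1 ≤ r.2 ∧ ((l / 2 : ℕ) : ℤ) ≤ r.2 - r.1 + 1 ∧
    ε * ((r.2 - r.1 + 1 : ℤ) : ℝ) ≤
      |(count ζ r.1 r.2 : ℝ) - ρ * ((r.2 - r.1 + 1 : ℤ) : ℝ)|} with hB
  have hsub : {ζ | ¬ IsTypical H l ρ ε ζ} ⊆ ⋃ r ∈ I ×ˢ I, B r := by
    intro ζ hζ
    simp only [IsTypical, Set.mem_ofPred_eq] at hζ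
    push Not at hζ
    obtain ⟨a, b, h1, h2, h3, h4, -, h6⟩ := hζ
    simp only [Set.mem_iUnion]
    exact ⟨(a, b), by simp [I]; omega, h2, h4, h6⟩
  have hbd : ∀ r ∈ I ×ˢ I, (E.μ ρ).real (B r) ≤ 2 * Real.exp (-c * ε ^ 2 * (l / 3)) := by
    rintro ⟨a, b⟩ -
    by_cases h : a ≤ b ∧ ((l / 2 : ℕ) : ℤ) ≤ b - a + 1
    · have hlen : (l : ℝ) / 3 ≤ ((b - a + 1 : ℤ) : ℝ) := by
        have : (l : ℤ) ≤ 3 * (b - a + 1) := by omega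
        have : (l : ℝ) ≤ 3 * ((b - a + 1 : ℤ) : ℝ) := by exact_mod_cast this
        linarith
      refine (measureReal_mono fun ζ hζ => hζ.2.2).trans
        ((measureReal_count_deviation_le hM hT hρ hD h.1).trans ?_)
      have := mul_le_mul_of_nonneg_left hlen (mul_nonneg hc.le (sq_nonneg ε))
      exact mul_le_mul_of_nonneg_left (Real.exp_le_exp.2 (by linarith)) zero_le_two
    · have : B (a, b) = ∅ := by
        ext ζ
        simp only [hB, Set.mem_ofPred_eq, Set.mem_empty_iff_false, iff_false]
        exact fun hh => h ⟨hh.1, hh.2.1⟩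
      rw [this, measureReal_empty]
      positivity
  calc (E.μ ρ).real {ζ | ¬ IsTypical H l ρ ε ζ} ≤ (E.μ ρ).real (⋃ r ∈ I ×ˢ I, B r) :=
        measureReal_mono hsub (measure_ne_top _ _)
    _ ≤ ∑ r ∈ I ×ˢ I, (E.μ ρ).real (B r) := measureReal_biUnion_finset_le _ _
    _ ≤ (I ×ˢ I).card • (2 * Real.exp (-c * ε ^ 2 * (l / 3))) := Finset.sum_le_card_nsmul _ _ _ hbd
    _ = _ := by rw [nsmul_eq_mul, Finset.card_product, Nat.cast_mul, hI]; ring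

/-! ### The gain over one block -/

section

/-- The mean displacement is almost monotone with respect to a domination on a finite window. -/
lemma meanDisplacement_le_of_le_on (hp0 : 0 ≤ pEmpty) (hp : pEmpty < pOcc) (hp1 : pOcc ≤ 1)
    {ν : ℝ} (hDrift : E.NoDriftFromSide ν) {L H : ℕ}
    (hH : L + 2 * ν * L ≤ (H : ℝ)) {ζ ζ' : Config}
    (hζ : ∀ x : ℤ, -(H : ℤ) ≤ x → x ≤ H → ζ' x ≤ ζ x) :
    E.meanDisplacement pEmpty pOcc L ζ' ≤
      E.meanDisplacement pEmpty pOcc L ζ + 2 * L * (20 * Real.exp (-(ν * L) / 4)) := by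
  -- With `k = 1` the window shrinks by `2νL` and still contains `[-L, L]`, which the walk cannot
  -- leave in `L` steps.
  obtain ⟨Q, hQ, hG⟩ := hDrift L H 1 le_rfl ζ ζ' hζ
  rw [Nat.cast_one, one_mul] at hG
  have := hQ.integral_le (measurable_walkMean_integerPath (pEmpty := pEmpty) (pOcc := pOcc) L
    (fun x => (x : ℝ)) 0) (measurable_walkMean_integerPath (pEmpty := pEmpty) (pOcc := pOcc) L
    (fun x => (x : ℝ)) 0) le_rfl (Nat.cast_nonneg L)
    (fun η => abs_walkMean_intCast_le hp0 hp hp1 L _)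
    (fun η => abs_walkMean_intCast_le hp0 hp hp1 L _) hG (fun r hr => by
      have h := walkMean_mono hp0 hp hp1 (f := fun x : ℤ => (x : ℝ)) (N := L) (y' := 0)
        Int.cast_mono (n := L) (e := integerPath r.1) (e' := integerPath r.2)
        (fun k hk x hx => hr k hk.le x (by
          have : -(L : ℝ) ≤ x := by exact_mod_cast (abs_le.1 hx).1
          linarith) (by
          have : (x : ℝ) ≤ L := by exact_mod_cast (abs_le.1 hx).2
          linarith)) (by simp) 0
      simpa only [Nat.cast_zero, mul_zero, add_zero] using h)
  rw [add_zero] at this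
  exact this

lemma walkMean_add_eq (n m : ℕ) (x : ℤ) (η : T → Config) :
    walkMean pEmpty pOcc m (fun k => integerPath η (n + k)) (fun x => (x : ℝ)) x =
      x + walkMean pEmpty pOcc m (integerPath (shiftPath (n : T) x η)) (fun x => (x : ℝ)) 0 := by
  have h := walkMean_translate (pEmpty := pEmpty) (pOcc := pOcc) x (fun x => (x : ℝ)) m
    (fun k => integerPath η (n + k)) 0
  rw [add_zero] at h
  rw [h, ← walkMean_const_add]
  simp only [integerPath, Nat.cast_add, Int.cast_add]
  rfl

/-- The walk is restarted at time `t` from its leftmost possible position `-t`. This position is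
deterministic, so what remains depends only on the law of the configuration at time `t`. -/
lemma integral_meanDisplacement_shift_le (hp0 : 0 ≤ pEmpty) (hp : pEmpty < pOcc) (hp1 : pOcc ≤ 1)
    (hM : E.MarkovInvariant) (t L : ℕ) (ζ : Config) :
    ∫ η, E.meanDisplacement pEmpty pOcc L (fun y => η (t : T) (-t + y)) ∂(E.law ζ) - t ≤
      E.meanDisplacement pEmpty pOcc (t + L) ζ := by
  have hmark := (hM.law ζ).integral_mul_comp_shiftPath (t : T) (-t) (φ := fun _ => 1) (c := 1)
    measurable_const (by simp)
    (measurable_walkMean_integerPath (pEmpty := pEmpty) (pOcc := pOcc) L (fun x => (x : ℝ)) 0)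
    (fun η => abs_walkMean_intCast_le hp0 hp hp1 L _)
  simp only [one_mul] at hmark
  have hm : Measurable fun η : T → Config =>
      walkMean pEmpty pOcc L (integerPath (shiftPath (t : T) (-t) η)) (fun x => (x : ℝ)) 0 :=
    (measurable_walkMean_integerPath L _ 0).comp (measurable_shiftPath _ _)
  have hi : Integrable (fun η : T → Config =>
      walkMean pEmpty pOcc L (integerPath (shiftPath (t : T) (-t) η)) (fun x => (x : ℝ)) 0)
      (E.law ζ) :=
    Integrable.of_bound hm.aestronglyMeasurable L
      (Eventually.of_forall fun η => abs_walkMean_intCast_le hp0 hp hp1 L _)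
  calc _ = ∫ η, (walkMean pEmpty pOcc L (integerPath (shiftPath (t : T) (-t) η))
        (fun x => (x : ℝ)) 0 - t) ∂(E.law ζ) := by
        rw [integral_sub hi (integrable_const _), hmark]
        simp [meanDisplacement]
    _ ≤ _ := by
        refine integral_mono (hi.sub (integrable_const _)) (Integrable.of_bound
          (measurable_walkMean_integerPath _ _ 0).aestronglyMeasurable ((t + L : ℕ) : ℝ)
          (Eventually.of_forall fun η => abs_walkMean_intCast_le hp0 hp hp1 _ _)) fun η => ?_
        have h1 := walkMean_restart_le hp0 hp hp1 (f := fun x : ℤ => (x : ℝ)) Int.cast_mono t L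
          (integerPath η) 0
        rw [zero_sub, walkMean_add_eq] at h1
        push_cast at h1
        linarith

/-- From a typical configuration of density `ρ + δ`, the walk moves almost as much as it does at
stationarity at density `ρ`. -/
lemma meanDisplacement_ge_of_isTypical (hp0 : 0 ≤ pEmpty) (hp : pEmpty < pOcc) (hp1 : pOcc ≤ 1)
    (hM : E.MarkovInvariant) (hS : E.Stationary)
    (hT : E.TranslationInvariant) {ν : ℝ} (hDrift : E.NoDriftFromSide ν)
    {ρ ρ' ε q N : ℝ} (hρ : ρ ∈ E.J) (hq : 0 ≤ q) {H H' l t L : ℕ}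
    (hcov : ∀ ζ ζ', IsTypical H l ρ' ε ζ → IsTypical H l ρ ε ζ' →
      ∃ Q : Measure ((T → Config) × (T → Config)), IsCoupling Q (E.law ζ) (E.law ζ') ∧
        1 - q ≤ Q.real {r | ∀ x : ℤ, -(H : ℝ) + 4 * ν * t ≤ x → (x : ℝ) ≤ H - 4 * ν * t →
          r.2 (t : T) x ≤ r.1 (t : T) x})
    (hH' : L + 2 * ν * L ≤ (H' : ℝ)) (hH : H' + t + 4 * ν * t ≤ (H : ℝ))
    (hN : (E.μ ρ).real {ζ | ¬ IsTypical H l ρ ε ζ} ≤ N) {ζ : Config}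
    (hζ : IsTypical H l ρ' ε ζ) :
    ∫ ξ, E.meanDisplacement pEmpty pOcc L ξ ∂(E.μ ρ) - t -
      2 * L * (q + 20 * Real.exp (-(ν * L) / 4) + N) ≤
        E.meanDisplacement pEmpty pOcc (t + L) ζ := by
  set F := E.meanDisplacement pEmpty pOcc L with hF
  set f : (T → Config) → ℝ := fun η => F (fun y => η (t : T) (-t + y)) with hf
  have hFm : Measurable F := measurable_meanDisplacement L
  have hfm : Measurable f :=
    hFm.comp (measurable_eval_translate (t : T) _)
  have hfL : ∀ η, |f η| ≤ L := fun η => abs_meanDisplacement_le hp0 hp hp1 L _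
  set e := 20 * Real.exp (-(ν * L) / 4) with he
  have he0 : 0 ≤ e := by positivity
  -- Cover up to time `t`, then keep the domination for `L` more steps. The window is centred at
  -- `-t`, whence the term `t` in `hH`.
  have hcmp : ∀ ζ', IsTypical H l ρ ε ζ' →
      ∫ η, f η ∂(E.law ζ') ≤ ∫ η, f η ∂(E.law ζ) + 2 * L * e + 2 * L * q := by
    intro ζ' hζ'
    obtain ⟨Q, hQ, hG⟩ := hcov ζ ζ' hζ hζ'
    refine hQ.integral_le hfm hfm (by positivity) (Nat.cast_nonneg L) hfL hfL hG fun r hr => ?_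
    refine meanDisplacement_le_of_le_on hp0 hp hp1 hDrift hH' fun x hx1 hx2 => hr _ ?_ ?_
    · have : -(H' : ℝ) ≤ x := by exact_mod_cast hx1
      push_cast; linarith
    · have : (x : ℝ) ≤ H' := by exact_mod_cast hx2
      push_cast
      have := Nat.cast_nonneg (α := ℝ) t
      linarith
  -- The configuration at time `t` seen from `-t` still has law `μ_ρ`.
  have hstat : ∫ ξ, F ξ ∂(E.μ ρ) = ∫ ζ', ∫ η, f η ∂(E.law ζ') ∂(E.μ ρ) := by
    conv_lhs => rw [← stationaryLaw_map_eval_translate hM hS hT hρ (t : T) (-t)]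
    rw [← integral_bind_kernel _ _ hfm hfL,
      integral_map (measurable_eval_translate (t : T) (-(t : ℤ))).aemeasurable hFm.aestronglyMeasurable]
    rfl
  set A : ℝ := ∫ η, f η ∂(E.law ζ) with hA
  have hAL : |A| ≤ L := by
    have := norm_integral_le_of_norm_le_const (μ := E.law ζ) (f := f) (Eventually.of_forall hfL)
    simpa using this
  have hfi : Integrable (fun ζ' => ∫ η, f η ∂(E.law ζ')) (E.μ ρ) := by
    refine Integrable.of_bound hfm.stronglyMeasurable.integral_kernel.aestronglyMeasurable L
      (Eventually.of_forall fun ζ' => ?_)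
    have := norm_integral_le_of_norm_le_const (μ := E.law ζ') (f := f) (Eventually.of_forall hfL)
    simpa using this
  have hbound := integral_le_of_le_off hfi (measurableSet_isTypical H l ρ ε).compl
    (B := A + 2 * L * e + 2 * L * q) (c := 2 * L) (by positivity) hN
    (fun ζ' hζ' => hcmp ζ' (not_not.1 hζ')) (fun ζ' => by
      have h1 := norm_integral_le_of_norm_le_const (μ := E.law ζ') (f := f)
        (Eventually.of_forall hfL)
      simp only [probReal_univ, mul_one, Real.norm_eq_abs] at h1
      have h2 := (abs_le.1 h1).2
      have h3 := (abs_le.1 hAL).1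
      have h4 : 0 ≤ 2 * (L : ℝ) * e + 2 * L * q := by positivity
      linarith)
  have := integral_meanDisplacement_shift_le hp0 hp hp1 hM t L ζ
  rw [hstat]
  change A - t ≤ _ at this
  linarith

end

end RandomEnvironment

/-! ### Chaining the blocks -/

namespace RandomEnvironment

variable {T : Type*} [CommSemiring T] [LinearOrder T] [IsStrictOrderedRing T]
  {E : RandomEnvironment T} {pEmpty pOcc : ℝ}

lemma measurable_past_walkMean (n : ℕ) (f : ℤ → ℝ) (y : ℤ) :
    Measurable[past (n : T)] fun η : T → Config =>
      walkMean pEmpty pOcc n (integerPath η) f y := by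
  set ext : ({r : T // r ≤ n} → Config) → ℕ → Config :=
    fun ξ k => if h : (k : T) ≤ n then ξ ⟨k, h⟩ else 0 with hext
  have hm : Measurable ext := by
    refine measurable_pi_lambda _ fun k => ?_
    by_cases h : (k : T) ≤ n
    · simp only [hext, h, dite_true]
      exact measurable_pi_apply _
    · simp only [hext, h, dite_false]
      exact measurable_const
  have heq : (fun η : T → Config => walkMean pEmpty pOcc n (integerPath η) f y) =
      (fun ξ => walkMean pEmpty pOcc n (ext ξ) f y) ∘
        fun (η : T → Config) (r : {r : T // r ≤ n}) => η r := by
    funext η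
    refine walkMean_congr_env (fun k hk => ?_) f y
    have h : (k : T) ≤ n := Nat.cast_le.2 hk.le
    simp only [hext, integerPath, dif_pos h]
  rw [heq]
  exact ((measurable_walkMean n f y).comp hm).comp (comap_measurable _)

/-- Decomposition according to the site `x` occupied at time `n`. It puts the future in the form of
the Markov property at a deterministic site. -/
lemma walkMean_add_eq_sum (hp0 : 0 ≤ pEmpty) (hp : pEmpty < pOcc) (hp1 : pOcc ≤ 1)
    (n m : ℕ) (η : T → Config) :
    walkMean pEmpty pOcc (n + m) (integerPath η) (fun x => (x : ℝ)) 0 =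
      walkMean pEmpty pOcc n (integerPath η) (fun x => (x : ℝ)) 0 +
        ∑ x ∈ Finset.Icc (-(n : ℤ)) n,
          walkMean pEmpty pOcc n (integerPath η) (fun z => if z = x then 1 else 0) 0 *
            walkMean pEmpty pOcc m (integerPath (shiftPath (n : T) x η)) (fun x => (x : ℝ)) 0 := by
  rw [walkMean_add, walkMean_eq_sum hp0 hp hp1,
    walkMean_eq_sum hp0 hp hp1 n (integerPath η) (fun x => (x : ℝ)), ← Finset.sum_add_distrib]
  refine Finset.sum_congr rfl fun x _ => ?_
  rw [walkMean_add_eq]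
  ring

/-- For each fixed `x`, the configuration at time `n` seen from `x` has law `μ_ρ`, hence lies in `S`
with probability at most `N`. There the loss is at most `2 * m`, and there are `2 * n + 1` sites.
Nothing is needed about the environment seen from the walker itself. -/
lemma integral_walkMean_add_ge (hp0 : 0 ≤ pEmpty) (hp : pEmpty < pOcc) (hp1 : pOcc ≤ 1)
    (hM : E.MarkovInvariant) (hS : E.Stationary)
    (hT : E.TranslationInvariant) {ρ : ℝ} (hρ : ρ ∈ E.J) (n m : ℕ) {b N : ℝ} {S : Set Config}
    (hSm : MeasurableSet S) (hN : (E.μ ρ).real S ≤ N) (hbm : b ≤ m)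
    (hb : ∀ ζ, ζ ∉ S → b ≤ E.meanDisplacement pEmpty pOcc m ζ) :
    ∫ η, walkMean pEmpty pOcc n (integerPath η) (fun x => (x : ℝ)) 0 ∂(E.stationaryLaw ρ) +
        (b - 2 * m * (2 * n + 1) * N) ≤
      ∫ η, walkMean pEmpty pOcc (n + m) (integerPath η) (fun x => (x : ℝ)) 0
        ∂(E.stationaryLaw ρ) := by
  set P := E.stationaryLaw ρ
  set I := Finset.Icc (-(n : ℤ)) n
  set π : ℤ → (T → Config) → ℝ := fun x η =>
    walkMean pEmpty pOcc n (integerPath η) (fun z => if z = x then 1 else 0) 0 with hπ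
  set g : (T → Config) → ℝ := fun η =>
    walkMean pEmpty pOcc m (integerPath η) (fun x => (x : ℝ)) 0 with hg
  set F := E.meanDisplacement pEmpty pOcc m with hF
  have π0 : ∀ x η, 0 ≤ π x η := fun x η => walkMean_indicator_nonneg hp0 hp hp1 n _ x 0
  have π1 : ∀ x η, π x η ≤ 1 := fun x η => walkMean_indicator_le_one hp0 hp hp1 n _ x 0
  have πabs : ∀ x η, |π x η| ≤ 1 := fun x η => by rw [abs_of_nonneg (π0 x η)]; exact π1 x η
  have πm : ∀ x, Measurable (π x) := fun x => measurable_walkMean_integerPath n _ 0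
  have πi : ∀ x, Integrable (π x) P := fun x => Integrable.of_bound
    (πm x).aestronglyMeasurable 1 (Eventually.of_forall (πabs x))
  have πsum : ∀ η, ∑ x ∈ I, π x η = 1 := fun η => by
    have h := walkMean_eq_sum hp0 hp hp1 n (integerPath η) (fun _ => 1)
    rw [walkMean_const] at h
    simpa using h.symm
  have gm : Measurable g := measurable_walkMean_integerPath m _ 0
  have gb : ∀ η, |g η| ≤ m := fun η => abs_walkMean_intCast_le hp0 hp hp1 m _
  have Fb : ∀ ζ, |F ζ| ≤ m := fun ζ => abs_meanDisplacement_le hp0 hp hp1 m ζ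
  have Fm : Measurable F := measurable_meanDisplacement m
  have iπg : ∀ x, Integrable (fun η => π x η * g (shiftPath (n : T) x η)) P := fun x =>
    Integrable.of_bound ((πm x).mul (gm.comp (measurable_shiftPath _ _))).aestronglyMeasurable
      (1 * m) (Eventually.of_forall fun η => by
        rw [norm_mul]; exact mul_le_mul (πabs x η) (gb _) (norm_nonneg _) zero_le_one)
  have iw : ∀ k : ℕ, Integrable (fun η : T → Config =>
      walkMean pEmpty pOcc k (integerPath η) (fun x => (x : ℝ)) 0) P := fun k =>
    Integrable.of_bound (measurable_walkMean_integerPath k _ 0).aestronglyMeasurable k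
      (Eventually.of_forall fun η => abs_walkMean_intCast_le hp0 hp hp1 k _)
  have key : ∀ x ∈ I, ∫ η, b * π x η ∂P - 2 * m * N ≤
      ∫ η, π x η * g (shiftPath (n : T) x η) ∂P := by
    intro x _
    rw [(hM.stationaryLaw ρ).integral_mul_comp_shiftPath (n : T) x
      (measurable_past_walkMean n _ 0) (πabs x) gm gb]
    have hShift : MeasurableSet {η : T → Config | (fun y => η (n : T) (x + y)) ∈ S} :=
      measurable_eval_translate (n : T) x hSm
    have hmeas : P.real {η : T → Config | (fun y => η (n : T) (x + y)) ∈ S} ≤ N := by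
      have h := map_measureReal_apply (μ := P) (measurable_eval_translate (n : T) x) hSm
      rw [stationaryLaw_map_eval_translate hM hS hT hρ] at h
      exact h.symm.trans_le hN
    have iF : Integrable (fun η : T → Config => π x η * F (fun y => η (n : T) (x + y))) P :=
      Integrable.of_bound
        ((πm x).mul (Fm.comp (measurable_eval_translate (n : T) x))).aestronglyMeasurable
        (1 * m) (Eventually.of_forall fun η => by
          rw [norm_mul]; exact mul_le_mul (πabs x η) (Fb _) (norm_nonneg _) zero_le_one)
    have ib : Integrable (fun η : T → Config => b * π x η) P := (πi x).const_mul b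
    have h := integral_le_of_le_off (ib.sub iF) hShift (B := 0) (c := 2 * m) (by positivity) hmeas
      (fun η hη => by
        simp only [Pi.sub_apply]
        nlinarith [mul_le_mul_of_nonneg_left (hb _ hη) (π0 x η)])
      (fun η => by
        simp only [Pi.sub_apply]
        have h1 := (abs_le.1 (Fb (fun y => η (n : T) (x + y)))).1
        have h2 := π0 x η
        have h3 := π1 x η
        have hm0 : (0 : ℝ) ≤ m := Nat.cast_nonneg m
        nlinarith [mul_nonneg h2 (sub_nonneg.2 hbm), mul_nonneg h2 (neg_le_iff_add_nonneg.1 h1),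
          mul_nonneg hm0 (sub_nonneg.2 h3)])
    rw [integral_sub' ib iF] at h
    change _ ≤ ∫ η, π x η * F (fun y => η (n : T) (x + y)) ∂P
    linarith
  have hcard : (I.card : ℝ) = 2 * n + 1 := by
    have : I.card = 2 * n + 1 := by simp [I]; omega
    rw [this]; push_cast; ring
  have hb1 : ∑ x ∈ I, ∫ η, b * π x η ∂P = b := by
    rw [← integral_finsetSum _ fun x _ => (πi x).const_mul b]
    simp only [← Finset.mul_sum, πsum]
    simp
  have hsum := Finset.sum_le_sum key
  rw [Finset.sum_sub_distrib, hb1, Finset.sum_const, nsmul_eq_mul, hcard,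
    ← integral_finsetSum _ fun x _ => iπg x] at hsum
  simp only [walkMean_add_eq_sum hp0 hp hp1 n m]
  rw [integral_add (iw n) (integrable_finsetSum _ fun x _ => iπg x)]
  change _ ≤ _ + ∫ η, ∑ x ∈ I, π x η * g (shiftPath (n : T) x η) ∂P
  linarith

/-- One application of the previous estimate per block; the starting time of each block is bounded
by `M` in the error. -/
lemma integral_walkMean_ge (hp0 : 0 ≤ pEmpty) (hp : pEmpty < pOcc) (hp1 : pOcc ≤ 1)
    (hM : E.MarkovInvariant) (hS : E.Stationary)
    (hT : E.TranslationInvariant) {ρ : ℝ} (hρ : ρ ∈ E.J) {m M : ℕ} (hm : 0 < m) {b N : ℝ}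
    {S : Set Config} (hSm : MeasurableSet S) (hN : (E.μ ρ).real S ≤ N) (hbm : b ≤ m)
    (hb : ∀ ζ, ζ ∉ S → b ≤ E.meanDisplacement pEmpty pOcc m ζ) :
    (M / m : ℕ) * (b - 2 * m * (2 * M + 1) * N) - m ≤
      ∫ η, walkMean pEmpty pOcc M (integerPath η) (fun x => (x : ℝ)) 0 ∂(E.stationaryLaw ρ) := by
  have hN0 : 0 ≤ N := measureReal_nonneg.trans hN
  have hblocks : ∀ j : ℕ, j * m ≤ M → j * (b - 2 * m * (2 * M + 1) * N) ≤
      ∫ η, walkMean pEmpty pOcc (j * m) (integerPath η) (fun x => (x : ℝ)) 0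
        ∂(E.stationaryLaw ρ) := by
    intro j
    induction j with
    | zero => intro _; simp [walkMean]
    | succ j ih =>
      intro hj
      rw [Nat.succ_mul] at hj ⊢
      have h1 := ih (by omega)
      have h2 := integral_walkMean_add_ge hp0 hp hp1 hM hS hT hρ (j * m) m hSm hN hbm hb
      have h3 : ((j * m : ℕ) : ℝ) ≤ M := by exact_mod_cast (by omega : j * m ≤ M)
      have h4 : 2 * m * (2 * ((j * m : ℕ) : ℝ) + 1) * N ≤ 2 * m * (2 * M + 1) * N := by
        gcongr
      push_cast at *
      linarith
  have h1 := hblocks (M / m) (Nat.div_mul_le_self M m)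
  -- The incomplete last block is bounded trivially, with no exceptional set.
  have h2 := integral_walkMean_add_ge hp0 hp hp1 hM hS hT hρ (M / m * m) (M % m)
    (b := -((M % m : ℕ) : ℝ)) (N := 0) MeasurableSet.empty (by simp)
    (by linarith [Nat.cast_nonneg (α := ℝ) (M % m)])
    (fun ζ _ => (abs_le.1 (abs_meanDisplacement_le hp0 hp hp1 (M % m) ζ)).1)
  have h3 : ((M % m : ℕ) : ℝ) ≤ m := by exact_mod_cast (Nat.mod_lt M hm).le
  have h4 : M / m * m + M % m = M := by rw [mul_comm]; exact Nat.div_add_mod M m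
  rw [h4] at h2
  linarith

end RandomEnvironment

/-- Comparison of a mean displacement `a` over a long time `M` with the sum of the mean
displacements `L * v` over the blocks. -/
lemma blockwise_average_le {v a R : ℝ} {L t M : ℕ} (hL : 0 < L) (htL : t ≤ L) (hLM : L ^ 2 ≤ M)
    (hv : |v| ≤ 1) (hR : 0 ≤ R)
    (h : (M / (t + L) : ℕ) * (L * v - t - R) - (t + L : ℕ) ≤ a) :
    v ≤ a / M + (4 / L + 2 * t / L + R / L) := by
  set j := M / (t + L)
  have hL' : (0 : ℝ) < L := by exact_mod_cast hL
  have hM' : (0 : ℝ) < M := by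
    exact_mod_cast lt_of_lt_of_le (by positivity : 0 < L ^ 2) hLM
  have hLM' : (L : ℝ) ^ 2 ≤ M := by exact_mod_cast hLM
  have htL' : (t : ℝ) ≤ L := by exact_mod_cast htL
  have ht0 : (0 : ℝ) ≤ t := Nat.cast_nonneg t
  have hj1 : (j : ℝ) * (t + L) ≤ M := by exact_mod_cast Nat.div_mul_le_self M (t + L)
  have hj2 : (M : ℝ) ≤ j * (t + L) + (t + L) := by
    have := Nat.lt_div_mul_add (a := M) (b := t + L) (by omega)
    exact_mod_cast this.le
  have hj0 : (0 : ℝ) ≤ j := Nat.cast_nonneg j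
  push_cast at h
  have hjL : (j : ℝ) * L ≤ M := by nlinarith
  have hv1 := (abs_le.1 hv).2
  have h1 : (j : ℝ) * L * v ≥ M * v - (M - j * L) := by nlinarith
  have hmain : M * v * L ≤ a * L + (4 * M + 2 * M * t + M * R) := by
    have e1 : (j : ℝ) * L * t ≤ M * t := mul_le_mul_of_nonneg_right hjL ht0
    have e2 : (j : ℝ) * L * R ≤ M * R := mul_le_mul_of_nonneg_right hjL hR
    -- The hypothesis `L ^ 2 ≤ M` makes the loss of about one block negligible: it costs `4 / L`.
    have e3 : 2 * ((t : ℝ) + L) * L ≤ 4 * M := by nlinarith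
    have e4 : M * v ≤ a + 2 * (t + L) + 2 * (j * t) + j * R := by nlinarith
    nlinarith [mul_le_mul_of_nonneg_right e4 hL'.le]
  have : v = M * v * L / (M * L) := by field_simp
  rw [this, show a / M + (4 / L + 2 * t / L + R / L) =
    (a * L + (4 * M + 2 * M * t + M * R)) / (M * L) by field_simp]
  gcongr

namespace RandomEnvironment

variable {T : Type*} [CommSemiring T] [LinearOrder T] [IsStrictOrderedRing T]
    [CanonicallyOrderedAdd T] [Sub T] [OrderedSub T] [FloorSemiring T]
    {E : RandomEnvironment T} {pEmpty pOcc : ℝ}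

/-- Comparison of the speeds at two densities and at two scales. -/
lemma rangeSpeed_le_rangeSpeed_add (hp0 : 0 ≤ pEmpty) (hp : pEmpty < pOcc) (hp1 : pOcc ≤ 1)
    (hM : E.MarkovInvariant) (hS : E.Stationary)
    (hT : E.TranslationInvariant) {ν : ℝ} (hDrift : E.NoDriftFromSide ν)
    {ρ ρ' ε q N : ℝ} (hρ : ρ ∈ E.J) (hρ' : ρ' ∈ E.J) (hq : 0 ≤ q) {H H' l t L M : ℕ}
    (hcov : ∀ ζ ζ', IsTypical H l ρ' ε ζ → IsTypical H l ρ ε ζ' →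
      ∃ Q : Measure ((T → Config) × (T → Config)), IsCoupling Q (E.law ζ) (E.law ζ') ∧
        1 - q ≤ Q.real {r | ∀ x : ℤ, -(H : ℝ) + 4 * ν * t ≤ x → (x : ℝ) ≤ H - 4 * ν * t →
          r.2 (t : T) x ≤ r.1 (t : T) x})
    (hH' : L + 2 * ν * L ≤ (H' : ℝ)) (hH : H' + t + 4 * ν * t ≤ (H : ℝ))
    (hN : (E.μ ρ).real {ζ | ¬ IsTypical H l ρ ε ζ} ≤ N)
    (hN' : (E.μ ρ').real {ζ | ¬ IsTypical H l ρ' ε ζ} ≤ N)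
    (hL : 0 < L) (htL : t ≤ L) (hLM : L ^ 2 ≤ M) :
    E.rangeSpeed pEmpty pOcc ρ L ≤ E.rangeSpeed pEmpty pOcc ρ' M +
      (4 / L + 2 * t / L + (2 * (q + 20 * Real.exp (-(ν * L) / 4) + N) + 4 * (2 * M + 1) * N)) := by
  have hN0 : 0 ≤ N := measureReal_nonneg.trans hN
  have hL' : (0 : ℝ) < L := by exact_mod_cast hL
  have htL' : (t : ℝ) ≤ L := by exact_mod_cast htL
  set e := 20 * Real.exp (-(ν * L) / 4) with he
  have he0 : 0 ≤ e := by positivity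
  have hvL : (L : ℝ) * E.rangeSpeed pEmpty pOcc ρ L =
      ∫ ξ, E.meanDisplacement pEmpty pOcc L ξ ∂(E.μ ρ) := by
    rw [rangeSpeed_eq hp0 hp hp1, integral_stationaryLaw_walkMean hp0 hp hp1,
      mul_div_cancel₀ _ hL'.ne']
  have hv := abs_rangeSpeed_le (E := E) hp0 hp hp1 ρ L
  set v := E.rangeSpeed pEmpty pOcc ρ L
  -- The guaranteed gain must not exceed the block length, since it is compared on bad
  -- configurations with a displacement of at least minus that length.
  have hvt : (L : ℝ) * v - t - 2 * L * (q + e + N) ≤ ((t + L : ℕ) : ℝ) := by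
    have h1 : (L : ℝ) * v ≤ L := by nlinarith [(abs_le.1 hv).2]
    have h2 : 0 ≤ 2 * (L : ℝ) * (q + e + N) := by positivity
    push_cast
    linarith [Nat.cast_nonneg (α := ℝ) t]
  have hlow := integral_walkMean_ge hp0 hp hp1 hM hS hT hρ' (m := t + L) (M := M) (by omega)
    (measurableSet_isTypical H l ρ' ε).compl hN' hvt (fun ζ hζ => by
      rw [hvL]
      exact meanDisplacement_ge_of_isTypical hp0 hp hp1 hM hS hT hDrift hρ hq hcov hH' hH hN
        (not_not.1 hζ))
  have hR : 0 ≤ 2 * L * (q + e + N) + 2 * ((t + L : ℕ) : ℝ) * (2 * M + 1) * N := by positivity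
  have h := blockwise_average_le hL htL hLM hv hR (by
    refine le_trans (le_of_eq ?_) hlow
    ring)
  rw [← rangeSpeed_eq hp0 hp hp1] at h
  refine h.trans ?_
  gcongr
  rw [div_le_iff₀ hL']
  push_cast
  have : 2 * ((t : ℝ) + L) * ((2 * M + 1) * N) ≤ 2 * (L + L) * ((2 * M + 1) * N) := by gcongr
  linarith

end RandomEnvironment

/-! ### Asymptotic estimates, with `t` the integer square root of `L` -/

/-- The power `1 / 8` appears because `δ ^ 2 * t ^ (1 / 4)` is at least of order `t ^ (1 / 8)` when
`δ` is at least of order `t ^ (-1 / 16)`. -/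
lemma eventually_pow_mul_exp_neg_le (A : ℝ) {κ : ℝ} (hκ : 0 < κ) (k : ℕ) :
    ∀ᶠ t : ℕ in atTop, A * (t : ℝ) ^ k * Real.exp (-κ * (t : ℝ) ^ (1 / 8 : ℝ)) ≤ (t : ℝ)⁻¹ := by
  have h1 : Tendsto (fun t : ℕ => (t : ℝ) ^ (1 / 8 : ℝ)) atTop atTop :=
    (tendsto_rpow_atTop (by norm_num)).comp tendsto_natCast_atTop_atTop
  have h2 := ((tendsto_rpow_mul_exp_neg_mul_atTop_nhds_zero ((8 * (k + 1) : ℕ) : ℝ) κ hκ).comp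
    h1).const_mul A
  rw [mul_zero] at h2
  filter_upwards [h2.eventually (gt_mem_nhds zero_lt_one), eventually_gt_atTop 0] with t ht ht0
  have ht' : (0 : ℝ) < t := by exact_mod_cast ht0
  have hpow : ((t : ℝ) ^ (1 / 8 : ℝ)) ^ ((8 * (k + 1) : ℕ) : ℝ) = (t : ℝ) ^ k * t := by
    rw [← Real.rpow_mul ht'.le, ← pow_succ, ← Real.rpow_natCast]
    congr 1
    push_cast
    ring
  simp only [Function.comp_apply, hpow] at ht
  rw [← one_div, le_div_iff₀ ht']
  calc _ = A * ((t : ℝ) ^ k * t * Real.exp (-κ * (t : ℝ) ^ (1 / 8 : ℝ))) := by ring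
    _ ≤ 1 := ht.le

/-- Serves the time condition in `Covering`: there `δ⁻¹ ^ 2` takes up one factor `t ^ (1 / 8)` of `t
^ (1 / 4)`, and the other one must beat the logarithm. -/
lemma eventually_log_cube_lt (A : ℝ) {ν : ℝ} (hν : 0 < ν) :
    ∀ᶠ t : ℕ in atTop, A * (1 + |Real.log (ν * t) ^ 3|) < ν * (t : ℝ) ^ (1 / 8 : ℝ) := by
  have hlin : Tendsto (fun t : ℕ => ν * (t : ℝ)) atTop atTop :=
    tendsto_natCast_atTop_atTop.const_mul_atTop hν
  have hlog : (fun x : ℝ => 1 + |Real.log x ^ 3|) =o[atTop] fun x => x ^ (1 / 8 : ℝ) := by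
    have h1 : (fun _ : ℝ => (1 : ℝ)) =o[atTop] fun x : ℝ => x ^ (1 / 8 : ℝ) :=
      (Asymptotics.isLittleO_const_left.2 (Or.inr
        (tendsto_norm_atTop_atTop.comp (tendsto_rpow_atTop (by norm_num)))))
    have h2 := isLittleO_log_rpow_rpow_atTop (3 : ℝ) (s := 1 / 8) (by norm_num)
    have h3 : (fun x : ℝ => Real.log x ^ 3) =o[atTop] fun x : ℝ => x ^ (1 / 8 : ℝ) := by
      simpa using h2
    exact h1.add h3.abs_left
  set c : ℝ := ν / (2 * (|A| + 1) * ν ^ (1 / 8 : ℝ)) with hc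
  have hνp : 0 < ν ^ (1 / 8 : ℝ) := Real.rpow_pos_of_pos hν _
  have hA : 0 < |A| + 1 := by positivity
  have hc0 : 0 < c := by positivity
  filter_upwards [(hlog.comp_tendsto hlin).bound hc0, eventually_gt_atTop 0] with t ht ht0
  have ht' : (0 : ℝ) < t := by exact_mod_cast ht0
  have hw : 0 < (t : ℝ) ^ (1 / 8 : ℝ) := Real.rpow_pos_of_pos ht' _
  simp only [Function.comp_apply, Real.norm_eq_abs] at ht
  rw [abs_of_nonneg (by positivity : 0 ≤ 1 + |Real.log (ν * t) ^ 3|),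
    abs_of_nonneg (by positivity : 0 ≤ (ν * (t : ℝ)) ^ (1 / 8 : ℝ)),
    Real.mul_rpow hν.le ht'.le] at ht
  calc A * (1 + |Real.log (ν * t) ^ 3|)
      ≤ (|A| + 1) * (c * (ν ^ (1 / 8 : ℝ) * (t : ℝ) ^ (1 / 8 : ℝ))) := by
        refine mul_le_mul (by linarith [le_abs_self A]) ht (by positivity) hA.le
    _ = ν * (t : ℝ) ^ (1 / 8 : ℝ) / 2 := by rw [hc]; field_simp
    _ < ν * (t : ℝ) ^ (1 / 8 : ℝ) := half_lt_self (by positivity)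

lemma eventually_mul_inv_le_rpow (A : ℝ) :
    ∀ᶠ t : ℕ in atTop, A * (t : ℝ)⁻¹ ≤ (t : ℝ) ^ (-(1 / 16) : ℝ) / 2 := by
  have h := ((tendsto_rpow_neg_atTop (y := 15 / 16) (by norm_num)).comp
    (tendsto_natCast_atTop_atTop (R := ℝ))).const_mul A
  rw [mul_zero] at h
  filter_upwards [h.eventually (gt_mem_nhds (show (0 : ℝ) < 1 / 2 by norm_num)),
    eventually_gt_atTop 0] with t ht ht0
  have ht' : (0 : ℝ) < t := by exact_mod_cast ht0
  have hinv : (t : ℝ)⁻¹ = (t : ℝ) ^ (-(15 / 16) : ℝ) * (t : ℝ) ^ (-(1 / 16) : ℝ) := by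
    rw [← Real.rpow_add ht', ← Real.rpow_neg_one]; norm_num
  simp only [Function.comp_apply] at ht
  rw [hinv, ← mul_assoc]
  nlinarith [Real.rpow_pos_of_pos ht' (-(1 / 16) : ℝ)]

lemma half_rpow_le_rpow {t L : ℝ} (ht : 0 < t) (hL : 0 < L) (h : L ≤ 4 * t ^ 2) :
    t ^ (-(1 / 16) : ℝ) / 2 ≤ L ^ (-(1 / 32) : ℝ) := by
  have h1 : (4 * t ^ 2) ^ (-(1 / 32) : ℝ) ≤ L ^ (-(1 / 32) : ℝ) :=
    Real.rpow_le_rpow_of_nonpos hL h (by norm_num)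
  have h2 : (t ^ 2) ^ (-(1 / 32) : ℝ) = t ^ (-(1 / 16) : ℝ) := by
    rw [← Real.rpow_natCast, ← Real.rpow_mul ht.le]; norm_num
  have h3 : (1 / 2 : ℝ) ≤ (4 : ℝ) ^ (-(1 / 32) : ℝ) := by
    calc (1 / 2 : ℝ) = (4 : ℝ) ^ (-(1 / 2) : ℝ) := by
          rw [show (4 : ℝ) = 2 ^ (2 : ℝ) by norm_num, ← Real.rpow_mul (by norm_num)]
          norm_num [Real.rpow_neg_one]
      _ ≤ _ := Real.rpow_le_rpow_of_exponent_le (by norm_num) (by norm_num)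
  rw [Real.mul_rpow (by norm_num) (by positivity), h2] at h1
  nlinarith [Real.rpow_pos_of_pos ht (-(1 / 16) : ℝ)]

lemma natSqrt_le_and_le {L : ℕ} (h : 1 ≤ Nat.sqrt L) :
    (Nat.sqrt L : ℝ) ^ 2 ≤ L ∧ (L : ℝ) ≤ 4 * (Nat.sqrt L : ℝ) ^ 2 := by
  have h1 : (L : ℝ) < ((Nat.sqrt L : ℝ) + 1) ^ 2 := by exact_mod_cast Nat.lt_succ_sqrt' L
  have h2 : (1 : ℝ) ≤ Nat.sqrt L := by exact_mod_cast h
  exact ⟨by exact_mod_cast Nat.sqrt_le' L, by nlinarith⟩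

lemma one_le_mul_sq_mul_rpow {t δ : ℝ} (ht : 0 < t) (h : t ^ (-(1 / 16) : ℝ) / 2 ≤ δ) :
    1 ≤ 4 * δ ^ 2 * t ^ (1 / 8 : ℝ) := by
  have hw : 0 < t ^ (1 / 8 : ℝ) := Real.rpow_pos_of_pos ht _
  have hr : 0 < t ^ (-(1 / 16) : ℝ) := Real.rpow_pos_of_pos ht _
  have hrw : (t ^ (-(1 / 16) : ℝ)) ^ 2 * t ^ (1 / 8 : ℝ) = 1 := by
    rw [← Real.rpow_natCast, ← Real.rpow_mul ht.le, ← Real.rpow_add ht]; norm_num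
  refine hrw.ge.trans ?_
  have h2 := pow_le_pow_left₀ hr.le (by linarith : t ^ (-(1 / 16) : ℝ) ≤ 2 * δ) 2
  calc (t ^ (-(1 / 16) : ℝ)) ^ 2 * t ^ (1 / 8 : ℝ) ≤ (2 * δ) ^ 2 * t ^ (1 / 8 : ℝ) := by gcongr
    _ = _ := by ring

lemma exp_neg_mul_sq_le {κ δ w x : ℝ} (hκ : 0 < κ) (hw : 0 < w) (h : 1 ≤ 4 * δ ^ 2 * w)
    (hx : w ^ 2 ≤ x) : Real.exp (-κ * δ ^ 2 * x) ≤ Real.exp (-(κ / 4) * w) := by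
  rw [Real.exp_le_exp]
  have h1 := mul_le_mul_of_nonneg_left h (mul_pos hκ hw).le
  have h2 := mul_le_mul_of_nonneg_left hx (mul_nonneg hκ.le (sq_nonneg δ))
  nlinarith

/-! ### Comparison of the scales `L` and `M`, with `L² ≤ M ≤ L⁴` -/

namespace RandomEnvironment

variable {T : Type*} [CommSemiring T] [LinearOrder T] [IsStrictOrderedRing T]
    [CanonicallyOrderedAdd T] [Sub T] [OrderedSub T] [FloorSemiring T]
    {E : RandomEnvironment T} {pEmpty pOcc : ℝ}

set_option maxHeartbeats 600000 in
lemma exists_rangeSpeed_le_of_le_pow (hp0 : 0 ≤ pEmpty) (hp : pEmpty < pOcc) (hp1 : pOcc ≤ 1)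
    (hM : E.MarkovInvariant) (hS : E.Stationary) (hT : E.TranslationInvariant)
    (hDens : E.DensityAtStationarity) {ν : ℝ} (hν : 0 < ν) (hDrift : E.NoDriftFromSide ν)
    (hCover : E.Covering ν) :
    ∃ L₀ : ℕ, 1 ≤ L₀ ∧ ∀ L ≥ L₀, ∀ δ : ℝ, (L : ℝ) ^ (-(1 / 32) : ℝ) ≤ δ → δ < 1 →
      ∀ ρ ∈ E.J, ρ + δ ∈ E.J → ∀ M : ℕ, L ^ 2 ≤ M → M ≤ L ^ 4 →
        E.rangeSpeed pEmpty pOcc ρ L ≤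
          E.rangeSpeed pEmpty pOcc (ρ + δ) M + (L : ℝ) ^ (-(1 / 32) : ℝ) := by
  obtain ⟨c, hc, hD⟩ := hDens
  obtain ⟨C, C', hC, hC', hcov⟩ := hCover
  set κ := (C' * (1 + ν⁻¹))⁻¹ with hκ
  have hκ0 : 0 < κ := by positivity
  -- The windows `H' = h₁ * L` and `H = (h₁ + h₂) * L` leave room for the walk and for both boundary
  -- effects.
  set h₁ := ⌈1 + 2 * ν⌉₊
  set h₂ := ⌈1 + 4 * ν⌉₊
  set h := h₁ + h₂
  -- Here `2054 = 6 + 8 * 256` comes from `M ≤ 256 t⁸`, the power 12 is `t⁸` times `H²` of order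
  -- `t⁴`, and `384 = 4 * 96` comes from `(δ / 4) ^ 2 * l / 3 = δ ^ 2 * (2 * l) / 96`. The 9 adds
  -- the five errors `4 + 2 + 1 + 1 + 1`, in units of `t⁻¹`. Finally `t ≥ 16` gives `t ^ (1 / 4) ≥
  -- 2`, so the floor `l` loses at most half.
  have ev := (((((((eventually_pow_mul_exp_neg_le (2054 * (2 * (8 * h + 1) ^ 2))
    (κ := c / 384) (by positivity) 12).and
    (eventually_pow_mul_exp_neg_le (2 * (C' * (4 * h))) (κ := κ / 4) (by positivity) 3)).and
    (eventually_pow_mul_exp_neg_le 40 (κ := ν / 4) (by positivity) 0)).and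
    (eventually_log_cube_lt (4 * C) hν)).and (eventually_mul_inv_le_rpow 9)).and
    ((tendsto_natCast_atTop_atTop (R := ℝ)).const_mul_atTop (pow_pos hν 8)
      |>.eventually_gt_atTop 1)).and (eventually_ge_atTop 16))
  obtain ⟨t₀, ht₀⟩ := eventually_atTop.1 ev
  refine ⟨t₀ ^ 2 + 1, by omega, fun L hL δ hδ hδ1 ρ hρ hρ' M hLM hML => ?_⟩
  have hL0 : 0 < L := by omega
  set t := Nat.sqrt L with ht
  obtain ⟨⟨⟨⟨⟨⟨evN, evq⟩, eve⟩, evlog⟩, ev9⟩, evν⟩, ev16⟩ :=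
    ht₀ t (Nat.le_sqrt'.2 (by omega))
  have t16 : (16 : ℝ) ≤ t := by exact_mod_cast ev16
  have tpos : (0 : ℝ) < t := by linarith
  obtain ⟨tL', Lt'⟩ := natSqrt_le_and_le (L := L) (by omega)
  have Lpos : (0 : ℝ) < L := by exact_mod_cast hL0
  have htleL : t ≤ L := Nat.sqrt_le_self L
  have hs := half_rpow_le_rpow tpos Lpos Lt'
  set w := (t : ℝ) ^ (1 / 8 : ℝ) with hw
  have wpos : 0 < w := Real.rpow_pos_of_pos tpos _
  have w2 : (t : ℝ) ^ (1 / 4 : ℝ) = w ^ 2 := by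
    rw [hw, ← Real.rpow_natCast, ← Real.rpow_mul tpos.le]; norm_num
  have wt : w ≤ t := by
    rw [hw]
    exact (Real.rpow_le_rpow_of_exponent_le (by linarith) (by norm_num)).trans
      (Real.rpow_one (t : ℝ)).le
  have w2two : 2 ≤ w ^ 2 := by
    rw [← w2]
    calc (2 : ℝ) = (16 : ℝ) ^ (1 / 4 : ℝ) := by
          rw [show (16 : ℝ) = 2 ^ (4 : ℝ) by norm_num, ← Real.rpow_mul (by norm_num)]; norm_num
      _ ≤ _ := Real.rpow_le_rpow (by norm_num) t16 (by norm_num)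
  have δpos : 0 < δ := (Real.rpow_pos_of_pos Lpos _).trans_le hδ
  have δw : 1 ≤ 4 * δ ^ 2 * w := one_le_mul_sq_mul_rpow tpos (hs.trans hδ)
  set l := ⌊(t : ℝ) ^ (1 / 4 : ℝ)⌋₊ with hl
  have lw : w ^ 2 / 2 ≤ l := by
    have := Nat.lt_floor_add_one ((t : ℝ) ^ (1 / 4 : ℝ))
    rw [← hl, w2] at this
    linarith
  set H := h * L
  set H' := h₁ * L
  have hH' : L + 2 * ν * L ≤ (H' : ℝ) := by
    have := mul_le_mul_of_nonneg_right (Nat.le_ceil (1 + 2 * ν)) Lpos.le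
    simp only [H']; push_cast
    linarith
  have htL' : (t : ℝ) ≤ L := by exact_mod_cast htleL
  have hH : H' + t + 4 * ν * t ≤ (H : ℝ) := by
    have h1 : (1 + 4 * ν) * t ≤ h₂ * L :=
      mul_le_mul (Nat.le_ceil (1 + 4 * ν)) htL' tpos.le (Nat.cast_nonneg _)
    simp only [H', H, h]; push_cast
    linarith
  have hHpos : 4 * ν * t < (H : ℝ) := by
    have : (0 : ℝ) ≤ H' := Nat.cast_nonneg _
    linarith
  have H1 : 1 ≤ H := by
    have : (0 : ℝ) < H := lt_trans (by positivity) hHpos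
    exact_mod_cast this
  have Ht : (H : ℝ) ≤ 4 * h * (t : ℝ) ^ 2 := by
    calc (H : ℝ) = h * L := Nat.cast_mul _ _
      _ ≤ h * (4 * (t : ℝ) ^ 2) := by gcongr
      _ = _ := by ring
  set q := C' * t * H * Real.exp (-κ * δ ^ 2 * (t : ℝ) ^ (1 / 4 : ℝ)) with hq
  set N := (2 * (H : ℝ) + 1) ^ 2 * (2 * Real.exp (-c * (δ / 4) ^ 2 * (l / 3))) with hN
  -- A tolerance of `δ / 4` around `ρ + δ` and `ρ` gives exactly the thresholds `ρ + 3δ/4` and `ρ +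
  -- δ/4` of the covering condition.
  have hcoupling : ∀ ζ ζ', IsTypical H l (ρ + δ) (δ / 4) ζ → IsTypical H l ρ (δ / 4) ζ' →
      ∃ Q : Measure ((T → Config) × (T → Config)), IsCoupling Q (E.law ζ) (E.law ζ') ∧
        1 - q ≤ Q.real {r | ∀ x : ℤ, -(H : ℝ) + 4 * ν * t ≤ x → (x : ℝ) ≤ H - 4 * ν * t →
          r.2 (t : T) x ≤ r.1 (t : T) x} := by
    intro ζ ζ' hζ hζ'
    refine hcov ρ hρ δ ⟨δpos, hδ1⟩ hρ' H t H1 (by omega) hHpos evν ?_ l hl ζ ζ'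
      fun a b h1 h2 h3 h4 h5 => ⟨?_, ?_⟩
    · rw [w2]
      have h1 : δ⁻¹ ^ 2 ≤ 4 * w := by
        rw [inv_pow, inv_le_iff_one_le_mul₀ (by positivity)]
        linarith
      calc C * δ⁻¹ ^ 2 * (1 + |Real.log (ν * t) ^ 3|)
          ≤ C * (4 * w) * (1 + |Real.log (ν * t) ^ 3|) := by gcongr
        _ = 4 * C * (1 + |Real.log (ν * t) ^ 3|) * w := by ring
        _ < ν * w * w := mul_lt_mul_of_pos_right evlog wpos
        _ = ν * w ^ 2 := by ring
    · have := (abs_lt.1 (hζ a b h1 h2 h3 h4 h5)).1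
      linarith
    · have := (abs_lt.1 (hζ' a b h1 h2 h3 h4 h5)).2
      linarith
  have hmain := rangeSpeed_le_rangeSpeed_add hp0 hp hp1 hM hS hT hDrift hρ hρ'
    (by positivity : 0 ≤ q) hcoupling hH' hH
    (measureReal_not_isTypical_le hM hT hc hρ (hD ρ hρ (δ / 4) ⟨by linarith, by linarith⟩) H l)
    (measureReal_not_isTypical_le hM hT hc hρ' (hD _ hρ' (δ / 4) ⟨by linarith, by linarith⟩) H l)
    hL0 htleL hLM
  refine hmain.trans (add_le_add le_rfl ?_)
  refine le_trans ?_ (ev9.trans hs)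
  have b1 : 4 / (L : ℝ) ≤ 4 * (t : ℝ)⁻¹ := by
    rw [div_eq_mul_inv]; gcongr
  have b2 : 2 * (t : ℝ) / L ≤ 2 * (t : ℝ)⁻¹ := by
    rw [div_le_iff₀ Lpos]
    calc 2 * (t : ℝ) = 2 * (t : ℝ)⁻¹ * (t : ℝ) ^ 2 := by field_simp
      _ ≤ _ := by gcongr
  have b3 : 2 * q ≤ (t : ℝ)⁻¹ := by
    refine le_trans ?_ evq
    have e1 := exp_neg_mul_sq_le hκ0 wpos δw w2.ge
    calc 2 * q ≤ 2 * (C' * t * (4 * h * (t : ℝ) ^ 2) * Real.exp (-(κ / 4) * w)) := by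
          rw [hq]; gcongr
      _ = _ := by ring
  have b4 : 2 * (20 * Real.exp (-(ν * L) / 4)) ≤ (t : ℝ)⁻¹ := by
    refine le_trans ?_ eve
    have e1 : Real.exp (-(ν * L) / 4) ≤ Real.exp (-(ν / 4) * w) := by
      rw [Real.exp_le_exp]
      have : ν * w ≤ ν * L := mul_le_mul_of_nonneg_left (wt.trans htL') hν.le
      linarith
    linarith
  have b5 : 2 * N + 4 * (2 * M + 1) * N ≤ (t : ℝ)⁻¹ := by
    refine le_trans ?_ evN
    have e1 : Real.exp (-c * (δ / 4) ^ 2 * (l / 3)) ≤ Real.exp (-(c / 384) * w) := by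
      have h1 := exp_neg_mul_sq_le (κ := c / 96) (by positivity) wpos δw
        (show w ^ 2 ≤ 2 * l by linarith)
      rw [show -c * (δ / 4) ^ 2 * (l / 3 : ℝ) = -(c / 96) * δ ^ 2 * (2 * l) by ring]
      rwa [show c / 384 = c / 96 / 4 by ring]
    have t2 : (1 : ℝ) ≤ (t : ℝ) ^ 2 := one_le_pow₀ (by linarith)
    have e2 : 2 * (H : ℝ) + 1 ≤ (8 * h + 1) * (t : ℝ) ^ 2 := by linarith
    have e3 : N ≤ ((8 * h + 1) * (t : ℝ) ^ 2) ^ 2 * (2 * Real.exp (-(c / 384) * w)) := by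
      rw [hN]; gcongr
    have e4 : (M : ℝ) ≤ 256 * (t : ℝ) ^ 8 := by
      have : (M : ℝ) ≤ (L : ℝ) ^ 4 := by exact_mod_cast hML
      calc (M : ℝ) ≤ (L : ℝ) ^ 4 := this
        _ ≤ (4 * (t : ℝ) ^ 2) ^ 4 := by gcongr
        _ = _ := by ring
    have t8 : (1 : ℝ) ≤ (t : ℝ) ^ 8 := one_le_pow₀ (by linarith)
    have e5 : 6 + 8 * (M : ℝ) ≤ 2054 * (t : ℝ) ^ 8 := by linarith
    calc 2 * N + 4 * (2 * M + 1) * N = (6 + 8 * M) * N := by ring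
      _ ≤ 2054 * (t : ℝ) ^ 8 *
          (((8 * h + 1) * (t : ℝ) ^ 2) ^ 2 * (2 * Real.exp (-(c / 384) * w))) := by gcongr
      _ = _ := by ring
  linarith

end RandomEnvironment

/-! ### Iteration over scales and passage to the limit -/

namespace RandomEnvironment

variable {T : Type*} [CommSemiring T] [LinearOrder T] [IsStrictOrderedRing T]
    [CanonicallyOrderedAdd T] [Sub T] [OrderedSub T] [FloorSemiring T]
    {E : RandomEnvironment T} {pEmpty pOcc : ℝ}

/-- Iteration of the comparison of two scales along `L, L², L⁴, …`, with a small increase of the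
density at each step. -/
lemma exists_rangeSpeed_le (hp0 : 0 ≤ pEmpty) (hp : pEmpty < pOcc) (hp1 : pOcc ≤ 1)
    (hM : E.MarkovInvariant) (hS : E.Stationary) (hT : E.TranslationInvariant)
    (hDens : E.DensityAtStationarity) {ν : ℝ} (hν : 0 < ν) (hDrift : E.NoDriftFromSide ν)
    (hCover : E.Covering ν) :
    ∃ L₀ : ℕ, ∀ L ≥ L₀, ∀ M : ℕ, L ^ 2 ≤ M → ∀ δ : ℝ, 3 * (L : ℝ) ^ (-(1 / 32) : ℝ) ≤ δ → δ < 1 →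
      ∀ ρ ∈ E.J, ρ + δ ∈ E.J → E.rangeSpeed pEmpty pOcc ρ L ≤
        E.rangeSpeed pEmpty pOcc (ρ + δ) M + 3 * (L : ℝ) ^ (-(1 / 32) : ℝ) := by
  obtain ⟨L₁, -, hL₁⟩ := exists_rangeSpeed_le_of_le_pow (E := E) hp0 hp hp1 hM hS hT hDens hν
    hDrift hCover
  have hlim : Tendsto (fun L : ℕ => (L : ℝ) ^ (-(1 / 32) : ℝ)) atTop (𝓝 0) :=
    (tendsto_rpow_neg_atTop (by norm_num)).comp tendsto_natCast_atTop_atTop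
  -- With `s = L ^ (-1 / 32)`, passing to `L²` replaces `s` by `s ^ 2`; the bound `s < 2 / 3` gives
  -- `s + 3 * s ^ 2 ≤ 3 * s`, so the budget `3 * s` reproduces itself for both the density and the
  -- error.
  obtain ⟨L₂, hL₂⟩ := eventually_atTop.1
    (hlim.eventually (gt_mem_nhds (show (0 : ℝ) < 2 / 3 by norm_num)))
  refine ⟨max (max L₁ L₂) 2, fun L hL M hLM => ?_⟩
  generalize hd : M - L = d
  induction d using Nat.strong_induction_on generalizing L with
  | _ d ih =>
    intro δ hδ hδ1 ρ hρ hρ'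
    have hL1 : L₁ ≤ L := le_trans (le_trans (le_max_left _ _) (le_max_left _ _)) hL
    have hL2 : L₂ ≤ L := le_trans (le_trans (le_max_right _ _) (le_max_left _ _)) hL
    have hL3 : 2 ≤ L := le_trans (le_max_right _ _) hL
    have Lpos : (0 : ℝ) < L := by exact_mod_cast (by omega : 0 < L)
    set s := (L : ℝ) ^ (-(1 / 32) : ℝ) with hs
    have spos : 0 < s := Real.rpow_pos_of_pos Lpos _
    have s23 : s < 2 / 3 := hL₂ L hL2
    by_cases hM4 : M ≤ L ^ 4
    · linarith [hL₁ L hL1 δ (by linarith) hδ1 ρ hρ hρ' M hLM hM4]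
    · have hlt : L < L ^ 2 := by nlinarith
      have hs2 : ((L ^ 2 : ℕ) : ℝ) ^ (-(1 / 32) : ℝ) = s ^ 2 := by
        rw [hs, Nat.cast_pow, ← Real.rpow_natCast, ← Real.rpow_natCast, ← Real.rpow_mul Lpos.le,
          ← Real.rpow_mul Lpos.le]
        congr 1
        norm_num
      have hmid : ρ + s ∈ E.J := ⟨by linarith [hρ.1], by linarith [hρ'.2]⟩
      have h1 := hL₁ L hL1 s le_rfl (by linarith) ρ hρ hmid (L ^ 2) le_rfl
        (Nat.pow_le_pow_right (by omega) (by norm_num))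
      have h2 := ih (M - L ^ 2) (by omega) (L ^ 2) (by omega)
        (by rw [← pow_mul]; exact (not_le.1 hM4).le) rfl (δ - s) (by rw [hs2]; nlinarith)
        (by linarith) (ρ + s) hmid (by rwa [add_add_sub_cancel])
      rw [hs2, add_add_sub_cancel] at h2
      nlinarith

lemma isBoundedUnder_rangeSpeed (hp0 : 0 ≤ pEmpty) (hp : pEmpty < pOcc) (hp1 : pOcc ≤ 1) (ρ : ℝ) :
    IsBoundedUnder (· ≤ ·) atTop (fun L : ℕ => E.rangeSpeed pEmpty pOcc ρ L) ∧
      IsBoundedUnder (· ≥ ·) atTop (fun L : ℕ => E.rangeSpeed pEmpty pOcc ρ L) :=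
  ⟨isBoundedUnder_of ⟨1, fun L => (abs_le.1 (abs_rangeSpeed_le hp0 hp hp1 ρ L)).2⟩,
    isBoundedUnder_of ⟨-1, fun L => (abs_le.1 (abs_rangeSpeed_le hp0 hp hp1 ρ L)).1⟩⟩

/-- For fixed large `L` the comparison holds for all `M ≥ L ^ 2`, so `M → ∞` yields the liminf; then
`L → ∞` removes the error. -/
lemma limsup_le_liminf_of_lt_one (hp0 : 0 ≤ pEmpty) (hp : pEmpty < pOcc) (hp1 : pOcc ≤ 1)
    (hM : E.MarkovInvariant) (hS : E.Stationary) (hT : E.TranslationInvariant)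
    (hDens : E.DensityAtStationarity) {ν : ℝ} (hν : 0 < ν) (hDrift : E.NoDriftFromSide ν)
    (hCover : E.Covering ν) {ρ ε : ℝ} (hρ : ρ ∈ E.J) (hε : 0 < ε) (hε1 : ε < 1)
    (hρε : ρ + ε ∈ E.J) :
    limsup (fun L : ℕ => E.rangeSpeed pEmpty pOcc ρ L) atTop ≤
      liminf (fun L : ℕ => E.rangeSpeed pEmpty pOcc (ρ + ε) L) atTop := by
  obtain ⟨L₀, hL₀⟩ := exists_rangeSpeed_le (E := E) hp0 hp hp1 hM hS hT hDens hν hDrift hCover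
  have hlim : Tendsto (fun L : ℕ => 3 * (L : ℝ) ^ (-(1 / 32) : ℝ)) atTop (𝓝 0) := by
    simpa using ((tendsto_rpow_neg_atTop (y := 1 / 32) (by norm_num)).comp
      (tendsto_natCast_atTop_atTop (R := ℝ))).const_mul 3
  set w := liminf (fun L : ℕ => E.rangeSpeed pEmpty pOcc (ρ + ε) L) atTop
  have hlim' : Tendsto (fun L : ℕ => w + 3 * (L : ℝ) ^ (-(1 / 32) : ℝ)) atTop (𝓝 w) := by
    simpa using hlim.const_add w
  rw [← hlim'.limsup_eq]
  refine limsup_le_limsup ?_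
    (isBoundedUnder_rangeSpeed hp0 hp hp1 ρ).2.isCoboundedUnder_le hlim'.isBoundedUnder_le
  filter_upwards [hlim.eventually (gt_mem_nhds hε), eventually_ge_atTop L₀] with L h1 h2
  have h3 : E.rangeSpeed pEmpty pOcc ρ L - 3 * (L : ℝ) ^ (-(1 / 32) : ℝ) ≤ w := by
    refine le_liminf_of_le (isBoundedUnder_rangeSpeed hp0 hp hp1 _).1.isCoboundedUnder_ge ?_
    filter_upwards [eventually_ge_atTop (L ^ 2)] with M hM'
    linarith [hL₀ L h2 M hM' ε h1.le hε1 ρ hρ hρε]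
  linarith

/-- The covering and density conditions concern gaps below 1; larger gaps are bisected, using liminf
≤ limsup at the midpoint. -/
lemma limsup_le_liminf (hp0 : 0 ≤ pEmpty) (hp : pEmpty < pOcc) (hp1 : pOcc ≤ 1)
    (hM : E.MarkovInvariant) (hS : E.Stationary) (hT : E.TranslationInvariant)
    (hDens : E.DensityAtStationarity) {ν : ℝ} (hν : 0 < ν) (hDrift : E.NoDriftFromSide ν)
    (hCover : E.Covering ν) {ρ ρ' : ℝ} (hρ : ρ ∈ E.J) (hρ' : ρ' ∈ E.J) (hlt : ρ < ρ') :
    limsup (fun L : ℕ => E.rangeSpeed pEmpty pOcc ρ L) atTop ≤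
      liminf (fun L : ℕ => E.rangeSpeed pEmpty pOcc ρ' L) atTop := by
  obtain ⟨n, hn⟩ := pow_unbounded_of_one_lt (ρ' - ρ) one_lt_two
  induction n generalizing ρ ρ' with
  | zero =>
    have h := limsup_le_liminf_of_lt_one (E := E) (ρ := ρ) (ε := ρ' - ρ) hp0 hp hp1 hM hS hT hDens hν
      hDrift hCover hρ (by linarith) (by simpa using hn) (by rwa [add_sub_cancel])
    rwa [add_sub_cancel] at h
  | succ n ih =>
    rw [pow_succ] at hn
    have hmid : (ρ + ρ') / 2 ∈ E.J := ⟨by linarith [hρ.1, hρ'.1], by linarith [hρ.2, hρ'.2]⟩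
    have hb := isBoundedUnder_rangeSpeed (E := E) hp0 hp hp1 ((ρ + ρ') / 2)
    exact (ih hρ hmid (by linarith) (by linarith)).trans
      ((liminf_le_limsup hb.1 hb.2).trans (ih hmid hρ' (by linarith) (by linarith)))

end RandomEnvironment

end

theorem proposition4p1 {T : Type*} [CommSemiring T] [LinearOrder T] [IsStrictOrderedRing T]
    [CanonicallyOrderedAdd T] [Sub T] [OrderedSub T] [FloorSemiring T]
    (E : RandomEnvironment T) (ν pEmpty pOcc : ℝ) (hν : 0 < ν)
    (hp0 : 0 ≤ pEmpty) (hp : pEmpty < pOcc) (hp1 : pOcc ≤ 1)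
    (hMarkov : E.MarkovInvariant) (hStat : E.Stationary) (hTrans : E.TranslationInvariant)
    (hMono : E.Monotonicity) (hDens : E.DensityAtStationarity)
    (hDrift : E.NoDriftFromSide ν) (hCover : E.Covering ν) :
    (∀ ρ ∈ E.J, ∀ ε : ℝ, 0 < ε → ρ + ε ∈ E.J →
      limsup (fun L : ℕ => E.rangeSpeed pEmpty pOcc ρ L) atTop ≤
        liminf (fun L : ℕ => E.rangeSpeed pEmpty pOcc (ρ + ε) L) atTop) ∧
    (E.J \ E.Jbar pEmpty pOcc).Countable ∧
    MonotoneOn (E.speed pEmpty pOcc) (E.Jbar pEmpty pOcc) := by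
  have hmain : ∀ ρ ∈ E.J, ∀ ρ' ∈ E.J, ρ < ρ' →
      limsup (fun L : ℕ => E.rangeSpeed pEmpty pOcc ρ L) atTop ≤
        liminf (fun L : ℕ => E.rangeSpeed pEmpty pOcc ρ' L) atTop := fun ρ hρ ρ' hρ' hlt =>
    RandomEnvironment.limsup_le_liminf hp0 hp hp1 hMarkov hStat hTrans hDens hν hDrift hCover
      hρ hρ' hlt
  have hbdd := fun ρ => E.isBoundedUnder_rangeSpeed hp0 hp hp1 ρ
  refine ⟨fun ρ hρ ε hε hρε => hmain ρ hρ _ hρε (by linarith), ?_, ?_⟩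
  · set lo : ℝ → ℝ := fun ρ => liminf (fun L : ℕ => E.rangeSpeed pEmpty pOcc ρ L) atTop
    set up : ℝ → ℝ := fun ρ => limsup (fun L : ℕ => E.rangeSpeed pEmpty pOcc ρ L) atTop
    have hlt : ∀ ρ ∈ E.J \ E.Jbar pEmpty pOcc, lo ρ < up ρ := by
      intro ρ hρ
      refine lt_of_le_of_ne (liminf_le_limsup (hbdd ρ).1 (hbdd ρ).2) fun heq => hρ.2 ⟨hρ.1, up ρ, ?_⟩
      exact tendsto_of_liminf_eq_limsup heq rfl (hbdd ρ).1 (hbdd ρ).2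
    -- Each density without a limit owns a non-empty open interval of speeds; disjoint ones are
    -- countable in number by separability of `ℝ`.
    have hdisj : (E.J \ E.Jbar pEmpty pOcc).PairwiseDisjoint
        fun ρ => Set.Ioo (lo ρ) (up ρ) := by
      have aux : ∀ ρ ∈ E.J, ∀ ρ' ∈ E.J, ρ < ρ' →
          Disjoint (Set.Ioo (lo ρ) (up ρ)) (Set.Ioo (lo ρ') (up ρ')) := by
        intro ρ hρ ρ' hρ' hlt
        rw [Set.disjoint_left]
        intro x hx hx'
        exact absurd (hx.2.trans_le (hmain ρ hρ ρ' hρ' hlt)) (not_lt.2 hx'.1.le)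
      intro ρ hρ ρ' hρ' hne
      rcases lt_or_gt_of_ne hne with h | h
      · exact aux ρ hρ.1 ρ' hρ'.1 h
      · exact (aux ρ' hρ'.1 ρ hρ.1 h).symm
    exact hdisj.countable_of_isOpen (fun _ _ => isOpen_Ioo) fun ρ hρ => Set.nonempty_Ioo.2 (hlt ρ hρ)
  · intro ρ hρ ρ' hρ' hle
    obtain ⟨hJ, a, ha⟩ := hρ
    obtain ⟨hJ', a', ha'⟩ := hρ'
    rcases hle.eq_or_lt with rfl | hlt
    · exact le_rfl
    · rw [RandomEnvironment.speed, RandomEnvironment.speed, ha.limUnder_eq, ha'.limUnder_eq,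
        ← ha.limsup_eq, ← ha'.liminf_eq]
      exact hmain ρ hJ ρ' hJ' hlt
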